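/- Let $n$ be a positive integer and $R$ a commutative ring. Let $\mathrm{Par}(n)$ be the set of partitions of $n$ with the dominance partial order $\trianglelefteq$ ($\lambda\trianglelefteq\mu$ iff $\lambda_1+\dots+\lambda_k\le\mu_1+\dots+\mu_k$ for all $k$); for $\lambda\in\mathrm{Par}(n)$ let $\lambda^*$ be the transpose partition and $f_\lambda$ the number of standard $\lambda$-tableaux, and put $\Gamma^*=\{\lambda^*\mid\lambda\in\Gamma\}$ for $\Gamma\subseteq\mathrm{Par}(n)$. Let $G(\Gamma)$ be the set of permutations $\sigma\in\mathrm{Sym}(n)$ such that the shape of the tableaux assigned to the word $\sigma(1)\sigma(2)\dots\sigma(n)$ by the Robinson--Schensted correspondence (row insertion) lies in $\Gamma$, and let $RG(\Gamma)$ be its $R$-span in the group algebra $R\,\mathrm{Sym}(n)$. For $\lambda=(\lambda_1,\dots,\lambda_m)\in\mathrm{Par}(n)$ let $\mathrm{Sym}(\lambda)=\mathrm{Sym}(X_1)\times\dots\times\mathrm{Sym}(X_m)\le\mathrm{Sym}(n)$, where $X_1=\{1,\dots,\lambda_1\}$, $X_2=\{\lambda_1+1,\dots,\lambda_1+\lambda_2\}$,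 and so on. For $\Delta\subseteq\mathrm{Par}(n)$ let $I_R(\Delta)$ be the two-sided ideal of $R\,\mathrm{Sym}(n)$ generated by the elements $\sum_{\sigma\in\mathrm{Sym}(\lambda)}\sigma$, $\lambda\in\Delta$. Let ${}^\dagger$ be the $R$-algebra automorphism of $R\,\mathrm{Sym}(n)$ with $\sigma^\dagger=\mathrm{sgn}(\sigma)\sigma$ for $\sigma\in\mathrm{Sym}(n)$, and let $I_R(\Delta)^\dagger$ be the image of $I_R(\Delta)$ under it. Let $\Gamma\subseteq\mathrm{Par}(n)$ be co-saturated (if $\mu\in\Gamma$ and $\mu\trianglelefteq\lambda$ then $\lambda\in\Gamma$) with a unique minimal element, and let $\Delta=\mathrm{Par}(n)\setminus\Gamma^*$. Then: (i) $R\,\mathrm{Sym}(n)=RG(\Gamma)\oplus I_R(\Delta)=RG(\Gamma)\oplus I_R(\Delta)^\dagger$ as $R$-modules. (ii) $I_R(\Delta)$ (resp. $I_R(\Delta)^\dagger$) is a free $R$-module of rank $\sum_{\lambda\in\Delta}f_\lambda^2$, and the natural map $R\otimes_{\mathbb Z}I_{\mathbb Z}(\Delta)\to I_R(\Delta)$ (resp.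 $R\otimes_{\mathbb Z}I_{\mathbb Z}(\Delta)^\dagger\to I_R(\Delta)^\dagger$), which sends $r\otimes x$ to $r$ times the image of $x$ in $R\,\mathrm{Sym}(n)$, is an isomorphism of $R$-modules. -/

import Mathlib

open scoped TensorProduct

/-! ## Partitions, the dominance order, conjugate partitions -/

namespace Nat.Partition

variable {n : ℕ}

/-- The parts of a partition in weakly decreasing order. -/
def rows (l : n.Partition) : List ℕ := l.parts.sort (· ≥ ·)

theorem rows_sortedGE (l : n.Partition) : l.rows.SortedGE :=
  (l.parts.pairwise_sort (· ≥ ·)).sortedGE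

theorem coe_rows (l : n.Partition) : (l.rows : Multiset ℕ) = l.parts :=
  Multiset.sort_eq _ _

/-- The sum of the first `k` (largest) parts. -/
def partialSum (l : n.Partition) (k : ℕ) : ℕ := (l.rows.take k).sum

theorem list_eq_of_take_sum : ∀ (a b : List ℕ), (∀ x ∈ a, 0 < x) → (∀ x ∈ b, 0 < x) →
    (∀ k, (a.take k).sum = (b.take k).sum) → a = b
  | [], [], _, _, _ => rfl
  | [], y :: ys, _, hb, h => by
      have h1 := h 1
      have h2 := hb y (by simp)
      simp at h1
      omega
  | x :: xs, [], ha, _, h => by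
      have h1 := h 1
      have h2 := ha x (by simp)
      simp at h1
      omega
  | x :: xs, y :: ys, ha, hb, h => by
      have hxy : x = y := by simpa using h 1
      subst hxy
      rw [list_eq_of_take_sum xs ys (fun z hz => ha z (by simp [hz]))
        (fun z hz => hb z (by simp [hz])) (fun k => by simpa using h (k + 1))]

theorem pos_of_mem_rows (l : n.Partition) (x : ℕ) (hx : x ∈ l.rows) : 0 < x := by
  apply l.parts_pos
  rw [← l.coe_rows]
  exact hx

/-- The dominance order: `l ≤ m` if and only if `l₁ + ⋯ + lₖ ≤ m₁ + ⋯ + mₖ` for all `k`. -/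
instance dominanceOrder : PartialOrder n.Partition where
  le l m := ∀ k, l.partialSum k ≤ m.partialSum k
  le_refl _ _ := le_rfl
  le_trans _ _ _ h₁ h₂ k := (h₁ k).trans (h₂ k)
  le_antisymm l m h₁ h₂ := by
    have h : l.rows = m.rows :=
      list_eq_of_take_sum _ _ l.pos_of_mem_rows m.pos_of_mem_rows
        (fun k => le_antisymm (h₁ k) (h₂ k))
    ext1
    rw [← l.coe_rows, ← m.coe_rows, h]

theorem sum_card_filter_lt (n : ℕ) (s : Multiset ℕ) (hs : ∀ x ∈ s, x ≤ n) :
    ((Multiset.range n).map fun j => (s.filter (j < ·)).card).sum = s.sum := by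
  induction s using Multiset.induction_on with
  | empty => simp
  | cons a s ih =>
    have ha : a ≤ n := hs a (by simp)
    have key : ((Multiset.range n).map fun j => if j < a then 1 else 0).sum = a := by
      change ∑ j ∈ Finset.range n, (if j < a then 1 else 0) = a
      rw [← Finset.sum_filter]
      have : (Finset.range n).filter (· < a) = Finset.range a := by
        ext j
        simp only [Finset.mem_filter, Finset.mem_range]
        omega
      simp [this]
    have e : (fun j => ((a ::ₘ s).filter (j < ·)).card)
        = fun j => (if j < a then 1 else 0) + (s.filter (j < ·)).card := by
      funext j
      by_cases h : j < a
      · simp [h, add_comm]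
      · simp [h]
    rw [e, Multiset.sum_map_add, key, ih (fun x hx => hs x (by simp [hx])), Multiset.sum_cons]

/-- The conjugate (transpose) partition: its parts are the numbers
`#{i | lᵢ > j}` for `j = 0, 1, …`, as long as they are nonzero. -/
def conj (l : n.Partition) : n.Partition :=
  ofSums n ((Multiset.range n).map fun j => (l.parts.filter (j < ·)).card)
    ((sum_card_filter_lt n l.parts (fun _ h => le_of_mem_parts h)).trans l.parts_sum)

/-- The Young diagram of a partition. -/
def diagram (l : n.Partition) : YoungDiagram := YoungDiagram.ofRowLens l.rows l.rows_sortedGE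

/-- Standard tableaux of shape `l`: bijective fillings of the cells `(i, j)` (row `i`, column `j`)
by `Fin n`, strictly increasing along the rows and down the columns. -/
def StandardTableau (l : n.Partition) : Type :=
  {T : l.diagram.cells ≃ Fin n //
    (∀ c d : l.diagram.cells, c.1.1 = d.1.1 → c.1.2 < d.1.2 → T c < T d) ∧
    (∀ c d : l.diagram.cells, c.1.2 = d.1.2 → c.1.1 < d.1.1 → T c < T d)}

/-- The number `f_l` of standard tableaux of shape `l`. -/
noncomputable def numStandard (l : n.Partition) : ℕ := Nat.card l.StandardTableau

/-- The `k`-th block (`k = 0, 1, …`) of consecutive elements, of size the `k`-th part of `l`. -/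
def block (l : n.Partition) (k : ℕ) : Set (Fin n) :=
  {i | l.partialSum k ≤ i ∧ (i : ℕ) < l.partialSum (k + 1)}

/-- The Young subgroup `Sym(l)`: the permutations that preserve every block of `l`. -/
def youngSubgroup (l : n.Partition) : Subgroup (Equiv.Perm (Fin n)) where
  carrier := {σ | ∀ k i, σ i ∈ l.block k ↔ i ∈ l.block k}
  one_mem' _ _ := Iff.rfl
  mul_mem' {_ τ} hσ hτ k i := (hσ k (τ i)).trans (hτ k i)
  inv_mem' {σ} hσ k i := by
    rw [← hσ k (σ⁻¹ i)]
    simp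

end Nat.Partition

/-! ## The Robinson–Schensted shape -/

namespace RobinsonSchensted

/-- Schensted insertion of `x` into a row: `x` replaces the first entry that is larger than `x`,
and this entry is returned; if there is none, `x` is put at the end of the row. -/
def rowInsert (x : ℕ) : List ℕ → List ℕ × Option ℕ
  | [] => ([x], none)
  | y :: ys =>
    if x < y then (x :: ys, some y) else (y :: (rowInsert x ys).1, (rowInsert x ys).2)

/-- Schensted insertion into a tableau (a list of rows): an entry that is bumped from a row is
inserted into the next row. -/
def tableauInsert (x : ℕ) : List (List ℕ) → List (List ℕ)
  | [] => [[x]]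
  | r :: rs =>
    match (rowInsert x r).2 with
    | none => (rowInsert x r).1 :: rs
    | some y => (rowInsert x r).1 :: tableauInsert y rs

/-- The insertion tableau of a word. -/
def insertionTableau (w : List ℕ) : List (List ℕ) :=
  w.foldl (fun T x => tableauInsert x T) []

theorem length_rowInsert (x : ℕ) (r : List ℕ) :
    (rowInsert x r).1.length + (rowInsert x r).2.toList.length = r.length + 1 := by
  induction r with
  | nil => simp [rowInsert]
  | cons y ys ih =>
    by_cases h : x < y
    · simp [rowInsert, h]
    · simp only [rowInsert, h, if_false, List.length_cons]
      omega

theorem sum_length_tableauInsert (T : List (List ℕ)) (x : ℕ) :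
    ((tableauInsert x T).map List.length).sum = (T.map List.length).sum + 1 := by
  induction T generalizing x with
  | nil => simp [tableauInsert]
  | cons r rs ih =>
    have h := length_rowInsert x r
    rw [tableauInsert]
    split
    · rename_i h'
      simp [h'] at h
      simp [h]
      omega
    · rename_i y h'
      simp [h'] at h
      simp [h, ih]
      omega

theorem sum_length_foldl (w : List ℕ) (T : List (List ℕ)) :
    ((w.foldl (fun T x => tableauInsert x T) T).map List.length).sum
      = (T.map List.length).sum + w.length := by
  induction w generalizing T with
  | nil => simp
  | cons x w ih =>
    rw [List.foldl_cons, ih, sum_length_tableauInsert, List.length_cons]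
    omega

/-- The word `σ(1) … σ(n)` of a permutation. -/
def word {n : ℕ} (σ : Equiv.Perm (Fin n)) : List ℕ := List.ofFn fun i => (σ i : ℕ)

/-- The Robinson–Schensted shape of (the word of) a permutation: the partition formed by
the row lengths of its insertion tableau. -/
def shape {n : ℕ} (σ : Equiv.Perm (Fin n)) : n.Partition :=
  Nat.Partition.ofSums n (((insertionTableau (word σ)).map List.length : List ℕ) : Multiset ℕ)
    (by rw [Multiset.sum_coe, insertionTableau, sum_length_foldl]; simp [word])

end RobinsonSchensted

/-! ## Submodules of the group algebra of the symmetric group -/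

namespace SymGroupAlgebra

variable {n : ℕ} (R : Type*) [CommRing R]

/-- `R G(Γ)`: the `R`-span of the permutations whose shape lies in `Γ`. -/
noncomputable def spanG (Γ : Finset n.Partition) : Submodule R (MonoidAlgebra R (Equiv.Perm (Fin n))) :=
  Submodule.span R (MonoidAlgebra.of R _ '' {σ | RobinsonSchensted.shape σ ∈ Γ})

open Classical in
/-- `[H]`: the sum of the elements of `H` in the group algebra. -/
noncomputable def groupSum (H : Subgroup (Equiv.Perm (Fin n))) :
    MonoidAlgebra R (Equiv.Perm (Fin n)) :=
  ∑ σ : Equiv.Perm (Fin n) with σ ∈ H, MonoidAlgebra.of R _ σ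

/-- `I_R(Δ)`: the two-sided ideal generated by the sums `[Sym(l)]` for `l ∈ Δ`,
as an `R`-submodule of the group algebra. -/
noncomputable def youngIdeal (Δ : Finset n.Partition) :
    Submodule R (MonoidAlgebra R (Equiv.Perm (Fin n))) :=
  (TwoSidedIdeal.span {x | ∃ l ∈ Δ, x = groupSum R l.youngSubgroup}).asIdeal.restrictScalars R

/-- The `R`-algebra endomorphism of the group algebra that underlies `†`: `σ ↦ sgn(σ) σ`. -/
noncomputable def daggerHom :
    MonoidAlgebra R (Equiv.Perm (Fin n)) →ₐ[R] MonoidAlgebra R (Equiv.Perm (Fin n)) :=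
  MonoidAlgebra.lift R _ _
    { toFun := fun σ => MonoidAlgebra.single σ (((Equiv.Perm.sign σ : ℤ) : R))
      map_one' := by simp [MonoidAlgebra.one_def]
      map_mul' := fun σ τ => by simp [MonoidAlgebra.single_mul_single] }

theorem daggerHom_single (σ : Equiv.Perm (Fin n)) (r : R) :
    daggerHom R (MonoidAlgebra.single σ r)
      = MonoidAlgebra.single σ (r * ((Equiv.Perm.sign σ : ℤ) : R)) := by
  simp [daggerHom, MonoidAlgebra.lift_single]

theorem daggerHom_comp :
    (daggerHom R).comp (daggerHom R) = AlgHom.id R (MonoidAlgebra R (Equiv.Perm (Fin n))) := by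
  ext σ : 2
  rcases Int.units_eq_one_or (Equiv.Perm.sign σ) with h | h <;>
    simp [daggerHom_single, h]

/-- The `R`-algebra automorphism `†` of the group algebra, `σ† = sgn(σ) σ`. -/
noncomputable def dagger :
    MonoidAlgebra R (Equiv.Perm (Fin n)) ≃ₐ[R] MonoidAlgebra R (Equiv.Perm (Fin n)) :=
  AlgEquiv.ofAlgHom (daggerHom R) (daggerHom R) (daggerHom_comp R) (daggerHom_comp R)

/-- `I_R(Δ)†`. -/
noncomputable def youngIdealDagger (Δ : Finset n.Partition) :
    Submodule R (MonoidAlgebra R (Equiv.Perm (Fin n))) :=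
  (youngIdeal R Δ).map ((dagger R).toLinearMap)

/-- The ring homomorphism `ℤ Sym(n) → R Sym(n)` that changes the coefficients. -/
noncomputable def fromInt :
    MonoidAlgebra ℤ (Equiv.Perm (Fin n)) →+* MonoidAlgebra R (Equiv.Perm (Fin n)) :=
  MonoidAlgebra.mapRingHom _ (Int.castRingHom R)

end SymGroupAlgebra

/-! ## Row lengths, conjugation and the dominance order -/

/-! The group algebra has a basis that is the same over every coefficient ring. For a pair (s, t) of
standard tableaux of one shape take the sum of the permutations that carry the rows of t to the rows
of s (`rowSum`), and the linear form that adds up, with signs, the coefficients at the permutations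
that carry the columns of t to the columns of s (`colForm`). If two entries share a row in one
tableau and a column in the other, a transposition cancels all terms. So a nonzero value of a form
at a row sum forces dominance of all subtableaux, and the matrix of values is triangular with
diagonal entries ±1 (`colForm_rowSum_ne_zero`, `isUnit_colForm_rowSum`). Independence over ℤ gives ∑
f_l² ≤ n!, and injectivity of the Robinson–Schensted map gives n! ≤ ∑ f_l². Hence the row sums form
a basis, and exactly f_l² permutations have shape l (`card_shape_eq`).

The set Δ is closed upwards because transposition reverses dominance. Forms of shapes outside Δ then
vanish on the ideal, so the ideal is spanned by the row sums of shapes in Δ (`youngIdeal_eq_span`).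
This gives the rank and the compatibility with change of rings.

The complement rests on one half of Greene's theorem. A permutation of shape l can be coloured with
decreasing classes whose sizes, truncated at k, add up to at most l₁ + ⋯ + lₖ
(`hasDecreasingColoring_word`). The colouring by columns achieves this for the reading word of a
tableau, and it is carried back along Knuth moves. If l is not in Γ, a k at which l fails to
dominate the least element of Γ yields class sizes that form a partition in Δ. The sum over the
permutations with the same colour pattern lies in the ideal, and σ is lexicographically largest
among them. So `codisjoint_spanG_youngIdeal` follows by straightening. Comparing ranks, a surjection
between free modules of equal finite rank being injective, makes the sum direct. The statements for
† follow by applying †, which only changes signs of permutations. -/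

theorem List.lt_length_filter_lt_iff {L : List ℕ} (hL : L.Pairwise (· ≥ ·)) (i j : ℕ) :
    i < (L.filter (j < ·)).length ↔ j < L.getD i 0 := by
  induction L generalizing i with
  | nil => simp
  | cons a L ih =>
    rw [List.pairwise_cons] at hL
    by_cases h : j < a
    · cases i with
      | zero => simp [h]
      | succ i => simpa [h] using ih hL.2 i
    · have h0 : L.filter (j < ·) = [] := by
        rw [List.filter_eq_nil_iff]
        intro b hb
        have := hL.1 b hb
        simp
        omega
      have h1 := ih hL.2
      rw [h0] at h1
      cases i with
      | zero => simp [h, h0]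
      | succ i => simpa [h, h0] using h1 i

theorem List.getD_filter_ne_zero {L : List ℕ} (hL : L.Pairwise (· ≥ ·)) (i : ℕ) :
    (L.filter (· ≠ 0)).getD i 0 = L.getD i 0 := by
  induction L generalizing i with
  | nil => simp
  | cons a L ih =>
    rw [List.pairwise_cons] at hL
    by_cases h : a = 0
    · have h0 : L.filter (· ≠ 0) = [] := by
        rw [List.filter_eq_nil_iff]
        intro b hb
        have := hL.1 b hb
        simp
        omega
      have h1 := ih hL.2
      rw [h0] at h1
      cases i with
      | zero => subst h; simpa using congrArg (fun l => l.getD 0 0) h0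
      | succ i =>
        subst h
        rw [List.filter_cons_of_neg (by simp), h0]
        simpa using h1 i
    · cases i with
      | zero => simp [h]
      | succ i => simpa [h] using ih hL.2 i

theorem List.sum_take_eq_sum_getD (L : List ℕ) (k : ℕ) :
    (L.take k).sum = ∑ i ∈ Finset.range k, L.getD i 0 := by
  induction L generalizing k with
  | nil => simp
  | cons a L ih =>
    cases k with
    | zero => simp
    | succ k => rw [List.take_succ_cons, List.sum_cons, Finset.sum_range_succ', ih]; simp [add_comm]

namespace Nat.Partition

variable {n : ℕ}

/-- The length of the `i`-th row; it is `0` beyond the last row. -/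
def rowLen (l : n.Partition) (i : ℕ) : ℕ := l.rows.getD i 0

theorem rows_pairwise (l : n.Partition) : l.rows.Pairwise (· ≥ ·) :=
  l.parts.pairwise_sort (· ≥ ·)

theorem rows_ofSums (L : List ℕ) (hL : L.Pairwise (· ≥ ·)) (h : (L : Multiset ℕ).sum = n) :
    (ofSums n L h).rows = L.filter (· ≠ 0) := by
  refine List.Perm.eq_of_pairwise (le := (· ≥ ·)) (fun a b _ _ h1 h2 => le_antisymm h2 h1)
    (rows_pairwise _) (hL.filter _) ?_
  rw [← Multiset.coe_eq_coe, coe_rows]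
  simp [ofSums]

theorem sum_rows (l : n.Partition) : l.rows.sum = n := by
  rw [← Multiset.sum_coe, coe_rows, l.parts_sum]

theorem length_rows_le (l : n.Partition) : l.rows.length ≤ n := by
  conv_rhs => rw [← l.sum_rows]
  exact List.length_le_sum_of_one_le _ l.pos_of_mem_rows

theorem partialSum_eq_sum (l : n.Partition) (k : ℕ) :
    l.partialSum k = ∑ i ∈ Finset.range k, l.rowLen i :=
  List.sum_take_eq_sum_getD _ _

theorem partialSum_of_le (l : n.Partition) {k : ℕ} (hk : n ≤ k) : l.partialSum k = n := by
  rw [partialSum, List.take_of_length_le (l.length_rows_le.trans hk), sum_rows]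

theorem partialSum_mono (l : n.Partition) : Monotone l.partialSum := by
  intro a b h
  rw [partialSum_eq_sum, partialSum_eq_sum]
  exact Finset.sum_le_sum_of_subset (Finset.range_mono h)

theorem eq_of_rowLen_eq {l m : n.Partition} (h : ∀ i, l.rowLen i = m.rowLen i) : l = m :=
  le_antisymm (fun k => by simp [partialSum_eq_sum, h]) (fun k => by simp [partialSum_eq_sum, h])

theorem rowLen_conj (l : n.Partition) (j : ℕ) :
    l.conj.rowLen j = (l.parts.filter (j < ·)).card := by
  have hsum : (((List.range n).map fun j => (l.parts.filter (j < ·)).card : List ℕ) :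
      Multiset ℕ).sum = n :=
    (sum_card_filter_lt n l.parts (fun _ h => le_of_mem_parts h)).trans l.parts_sum
  have hs : ((List.range n).map fun j => (l.parts.filter (j < ·)).card).Pairwise (· ≥ ·) := by
    rw [List.pairwise_map]
    refine List.pairwise_lt_range.imp fun {a b} h => ?_
    exact Multiset.card_le_card (Multiset.monotone_filter_right _ fun x hx => by omega)
  have h1 : l.conj.rows = _ := rows_ofSums _ hs hsum
  rw [rowLen, h1, List.getD_filter_ne_zero hs]
  by_cases hj : j < n
  · simp [List.getD, hj]
  · have : l.parts.filter (j < ·) = 0 := by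
      rw [Multiset.filter_eq_nil]
      intro a ha
      have := le_of_mem_parts ha
      omega
    rw [this]
    simp [List.getD, hj]

/-- Both sides say that the cell `(i, j)` lies in the diagram of `l`. -/
theorem lt_rowLen_conj (l : n.Partition) (i j : ℕ) : i < l.conj.rowLen j ↔ j < l.rowLen i := by
  rw [rowLen_conj, rowLen, ← List.lt_length_filter_lt_iff l.rows_pairwise, ← l.coe_rows]
  simp

theorem conj_conj (l : n.Partition) : l.conj.conj = l :=
  eq_of_rowLen_eq fun i => eq_of_forall_lt_iff fun j => by
    rw [lt_rowLen_conj, lt_rowLen_conj]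

theorem conj_injective : Function.Injective (conj : n.Partition → n.Partition) :=
  Function.LeftInverse.injective conj_conj

/-- The first `k` columns meet a row of length `p` in `min p k` cells. This is the same truncated
sum as in `RobinsonSchensted.weight`. -/
theorem partialSum_conj (l : n.Partition) (k : ℕ) :
    l.conj.partialSum k = (l.parts.map fun p => min p k).sum := by
  simp only [partialSum_eq_sum, rowLen_conj]
  induction l.parts using Multiset.induction_on with
  | empty => simp
  | cons a s ih =>
    have e : ∀ j, ((a ::ₘ s).filter (j < ·)).card
        = (if j < a then 1 else 0) + (s.filter (j < ·)).card := by
      intro j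
      by_cases h : j < a <;> simp [h, add_comm]
    simp only [e, Finset.sum_add_distrib, ih, Multiset.map_cons, Multiset.sum_cons]
    congr 1
    rw [← Finset.sum_filter]
    have : (Finset.range k).filter (· < a) = Finset.range (min a k) := by
      ext j
      simp
      omega
    simp [this]

theorem sum_map_parts (l : n.Partition) (g : ℕ → ℕ) (hg : g 0 = 0) :
    (l.parts.map g).sum = ∑ i ∈ Finset.range n, g (l.rowLen i) := by
  have h := List.sum_take_eq_sum_getD (l.rows.map g) n
  rw [List.take_of_length_le (by simpa using l.length_rows_le)] at h
  rw [← l.coe_rows, Multiset.map_coe, Multiset.sum_coe, h]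
  refine Finset.sum_congr rfl fun i _ => ?_
  rw [rowLen, ← hg, List.getD_map, hg]

/-- Cut the rows at the number `J` of rows of `l` longer than `k`. Truncation of `l` gives exactly
`k` for each row before the cut and changes nothing after it, while for `m` these values are upper
bounds. The part of `m` after the cut is at most that of `l`, by dominance at `J`. -/
theorem conj_antitone : Antitone (conj : n.Partition → n.Partition) := by
  intro l m h k
  rw [partialSum_conj, partialSum_conj, sum_map_parts _ _ (by simp), sum_map_parts _ _ (by simp)]
  set J := l.conj.rowLen k with hJ
  have hJn : J ≤ n := by
    by_contra hc
    have h1 := (lt_rowLen_conj l n k).1 (by omega)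
    have : l.rowLen n = 0 := by
      rw [rowLen, List.getD_eq_default _ _ l.length_rows_le]
    omega
  have split : ∀ f : ℕ → ℕ, ∑ i ∈ Finset.range n, f i
      = ∑ i ∈ Finset.range J, f i + ∑ i ∈ Finset.Ico J n, f i := fun f =>
    (Finset.sum_range_add_sum_Ico f hJn).symm
  have hl := l.partialSum_of_le le_rfl
  have hm := m.partialSum_of_le le_rfl
  have hlm := h J
  rw [partialSum_eq_sum] at hl hm
  rw [partialSum_eq_sum, partialSum_eq_sum] at hlm
  rw [split] at hl hm ⊢
  rw [split]
  have h1 : ∑ i ∈ Finset.range J, min (m.rowLen i) k ≤ ∑ i ∈ Finset.range J, k :=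
    Finset.sum_le_sum fun i _ => min_le_right _ _
  have h2 : ∑ i ∈ Finset.Ico J n, min (m.rowLen i) k ≤ ∑ i ∈ Finset.Ico J n, m.rowLen i :=
    Finset.sum_le_sum fun i _ => min_le_left _ _
  have h3 : ∑ i ∈ Finset.range J, min (l.rowLen i) k = ∑ i ∈ Finset.range J, k := by
    refine Finset.sum_congr rfl fun i hi => min_eq_right ?_
    exact ((lt_rowLen_conj l i k).1 (Finset.mem_range.1 hi)).le
  have h4 : ∑ i ∈ Finset.Ico J n, min (l.rowLen i) k = ∑ i ∈ Finset.Ico J n, l.rowLen i := by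
    refine Finset.sum_congr rfl fun i hi => min_eq_left ?_
    have := (lt_rowLen_conj l i k).not.1 (not_lt.2 (Finset.mem_Ico.1 hi).1)
    omega
  omega

theorem mem_diagram (l : n.Partition) (c : ℕ × ℕ) : c ∈ l.diagram.cells ↔ c.2 < l.rowLen c.1 := by
  rw [YoungDiagram.mem_cells, diagram, YoungDiagram.mem_ofRowLens, rowLen]
  constructor
  · rintro ⟨h, h'⟩
    simpa [List.getD, h] using h'
  · intro h
    have hc : c.1 < l.rows.length := by
      by_contra hc
      rw [List.getD_eq_default _ _ (not_lt.1 hc)] at h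
      omega
    exact ⟨hc, by simpa [List.getD, hc] using h⟩

/-- The cells of the conjugate partition are the transposed cells. -/
def conjCells (l : n.Partition) : l.conj.diagram.cells ≃ l.diagram.cells :=
  (Equiv.prodComm ℕ ℕ).subtypeEquiv fun c => by
    rw [mem_diagram, mem_diagram, lt_rowLen_conj]
    simp

theorem numStandard_conj (l : n.Partition) : l.conj.numStandard = l.numStandard := by
  refine Nat.card_congr (Equiv.subtypeEquiv (l.conjCells.equivCongr (Equiv.refl _)) ?_)
  intro T
  constructor
  · rintro ⟨h1, h2⟩
    exact ⟨fun c d h h' => h2 (l.conjCells.symm c) (l.conjCells.symm d) h h',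
      fun c d h h' => h1 (l.conjCells.symm c) (l.conjCells.symm d) h h'⟩
  · rintro ⟨h1, h2⟩
    refine ⟨fun c d h h' => ?_, fun c d h h' => ?_⟩
    · simpa using h2 (l.conjCells c) (l.conjCells d) h h'
    · simpa using h1 (l.conjCells c) (l.conjCells d) h h'

end Nat.Partition

/-! ## Insertion tableaux and recording tableaux -/

namespace RobinsonSchensted

/-- The row `s` may stand below the row `r`: it is not longer, and its entries are larger than
those above them. -/
def ColLT : List ℕ → List ℕ → Prop
  | _, [] => True
  | [], _ :: _ => False
  | a :: as, b :: bs => a < b ∧ ColLT as bs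

/-- Semistandard tableaux as lists of nonempty rows. -/
def IsTableau : List (List ℕ) → Prop
  | [] => True
  | r :: rs => r ≠ [] ∧ r.Pairwise (· ≤ ·) ∧ ColLT r (rs.headD []) ∧ IsTableau rs

theorem colLT_nil (r : List ℕ) : ColLT r [] := by cases r <;> trivial

/-! ### Insertion preserves tableaux -/

theorem mem_rowInsert {x b : ℕ} {r : List ℕ} (h : b ∈ (rowInsert x r).1) : b = x ∨ b ∈ r := by
  induction r with
  | nil => simpa [rowInsert] using h
  | cons a as ih => grind [rowInsert]

theorem self_mem_rowInsert (x : ℕ) (r : List ℕ) : x ∈ (rowInsert x r).1 := by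
  induction r with
  | nil => simp [rowInsert]
  | cons a as ih => grind [rowInsert]

theorem rowInsert_pairwise {x : ℕ} {r : List ℕ} (hr : r.Pairwise (· ≤ ·)) :
    (rowInsert x r).1.Pairwise (· ≤ ·) := by
  induction r with
  | nil => simp [rowInsert]
  | cons a as ih =>
    rw [List.pairwise_cons] at hr
    have ih := ih hr.2
    by_cases h : x < a
    · simp only [rowInsert, h, if_true, List.pairwise_cons]
      exact ⟨fun b hb => h.le.trans (hr.1 b hb), hr.2⟩
    · simp only [rowInsert, h, if_false, List.pairwise_cons]
      refine ⟨fun b hb => ?_, ih⟩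
      rcases mem_rowInsert hb with rfl | hb
      · omega
      · exact hr.1 b hb

theorem rowInsert_snd_eq_some {x y : ℕ} {r : List ℕ} (h : (rowInsert x r).2 = some y) :
    x < y ∧ y ∈ r := by
  induction r with
  | nil => simp [rowInsert] at h
  | cons a as ih => grind [rowInsert]

theorem rowInsert_snd_eq_none {x : ℕ} {r : List ℕ} (h : (rowInsert x r).2 = none) :
    (rowInsert x r).1 = r ++ [x] := by
  induction r with
  | nil => simp [rowInsert]
  | cons a as ih => grind [rowInsert]

theorem rowInsert_ne_nil (x : ℕ) (r : List ℕ) : (rowInsert x r).1 ≠ [] :=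
  List.ne_nil_of_mem (self_mem_rowInsert x r)

theorem ColLT.rowInsert_left {r s : List ℕ} (h : ColLT r s) (x : ℕ) :
    ColLT (rowInsert x r).1 s := by
  induction r generalizing s with
  | nil =>
    cases s with
    | nil => exact colLT_nil _
    | cons b bs => exact h.elim
  | cons a as ih =>
    cases s with
    | nil => exact colLT_nil _
    | cons b bs =>
      by_cases hx : x < a
      · simp only [rowInsert, hx, if_true]
        exact ⟨hx.trans h.1, h.2⟩
      · simp only [rowInsert, hx, if_false]
        exact ⟨h.1, ih h.2⟩

/-- The bumped `y` was smaller than the entry below it, so in the next row it lands weakly to the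
left of its old column. There the entries of the new upper row are smaller than `y`. -/
theorem ColLT.rowInsert_bump {r s : List ℕ} {x y : ℕ} (h : ColLT r s)
    (hy : (rowInsert x r).2 = some y) : ColLT (rowInsert x r).1 (rowInsert y s).1 := by
  induction r generalizing s with
  | nil => simp [rowInsert] at hy
  | cons a as ih =>
    by_cases hx : x < a
    · simp only [rowInsert, hx, if_true, Option.some.injEq] at hy ⊢
      subst hy
      cases s with
      | nil => exact ⟨hx, colLT_nil _⟩
      | cons b bs =>
        simp only [rowInsert, h.1, if_true]
        exact ⟨hx, h.2⟩
    · simp only [rowInsert, hx, if_false] at hy ⊢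
      have hxy := (rowInsert_snd_eq_some hy).1
      cases s with
      | nil => exact ⟨by omega, colLT_nil _⟩
      | cons b bs =>
        by_cases hb : y < b
        · simp only [rowInsert, hb, if_true]
          exact ⟨by omega, h.2.rowInsert_left x⟩
        · simp only [rowInsert, hb, if_false]
          exact ⟨h.1, ih h.2 hy⟩

theorem headD_tableauInsert (x : ℕ) (T : List (List ℕ)) :
    (tableauInsert x T).headD [] = (rowInsert x (T.headD [])).1 := by
  cases T with
  | nil => simp [tableauInsert, rowInsert]
  | cons r rs =>
    rw [tableauInsert]
    split <;> simp

theorem IsTableau.tableauInsert {T : List (List ℕ)} (hT : IsTableau T) (x : ℕ) :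
    IsTableau (tableauInsert x T) := by
  induction T generalizing x with
  | nil => simp [RobinsonSchensted.tableauInsert, IsTableau, colLT_nil]
  | cons r rs ih =>
    obtain ⟨h1, h2, h3, h4⟩ := hT
    rw [RobinsonSchensted.tableauInsert]
    split
    · exact ⟨rowInsert_ne_nil _ _, rowInsert_pairwise h2, h3.rowInsert_left x, h4⟩
    · rename_i y hy
      refine ⟨rowInsert_ne_nil _ _, rowInsert_pairwise h2, ?_, ih h4 y⟩
      rw [headD_tableauInsert]
      exact h3.rowInsert_bump hy

theorem rowInsert_perm (x : ℕ) (r : List ℕ) :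
    ((rowInsert x r).2.toList ++ (rowInsert x r).1).Perm (x :: r) := by
  induction r with
  | nil => simp [rowInsert]
  | cons a as ih =>
    by_cases hx : x < a
    · simp only [rowInsert, hx, if_true, Option.toList_some]
      exact List.Perm.swap _ _ _
    · simp only [rowInsert, hx, if_false]
      exact List.perm_middle.trans ((ih.cons a).trans (List.Perm.swap _ _ _))

theorem flatten_tableauInsert_perm (x : ℕ) (T : List (List ℕ)) :
    (tableauInsert x T).flatten.Perm (x :: T.flatten) := by
  induction T generalizing x with
  | nil => simp [tableauInsert]
  | cons r rs ih =>
    have h := rowInsert_perm x r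
    rw [tableauInsert]
    split
    · rename_i h'
      rw [h'] at h
      simpa using h.append_right rs.flatten
    · rename_i y h'
      rw [h'] at h
      have := ((ih y).append_left (rowInsert x r).1)
      refine this.trans (List.perm_middle.trans ?_)
      simpa using h.append_right rs.flatten

/-- The index of the row that gets longer when `x` is inserted into a tableau. -/
def insertRow (x : ℕ) : List (List ℕ) → ℕ
  | [] => 0
  | r :: rs =>
    match (rowInsert x r).2 with
    | none => 0
    | some y => insertRow y rs + 1

/-- Reverse bumping: `x` is the last entry of the new row that is smaller than `y`, since the
entries to its right stood to the right of `y`. -/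
theorem rowInsert_injective {x x' y : ℕ} {r r' : List ℕ} (hr : r.Pairwise (· ≤ ·))
    (hr' : r'.Pairwise (· ≤ ·)) (h : (rowInsert x r).2 = some y) (h' : (rowInsert x' r').2 = some y)
    (e : (rowInsert x r).1 = (rowInsert x' r').1) : x = x' ∧ r = r' := by
  induction r generalizing r' with
  | nil => simp [rowInsert] at h
  | cons a as ih =>
    cases r' with
    | nil => simp [rowInsert] at h'
    | cons a' as' =>
      rw [List.pairwise_cons] at hr hr'
      have m := self_mem_rowInsert x as
      have m' := self_mem_rowInsert x' as'
      have l := (rowInsert_snd_eq_some h).1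
      have l' := (rowInsert_snd_eq_some h').1
      by_cases hx : x < a <;> by_cases hx' : x' < a' <;>
        simp only [rowInsert, hx, hx', if_true, if_false, Option.some.injEq, List.cons.injEq]
          at h h' e
      · grind
      · have := hr.1 x' (e.2 ▸ m')
        omega
      · have := hr'.1 x (e.2 ▸ m)
        omega
      · have := ih hr.2 hr'.2 h h' e.2
        grind

/-- The row that grew ends in the letter inserted there. Removing it and bumping backwards through
the rows above recovers everything. -/
theorem tableauInsert_injective {x x' : ℕ} {T T' : List (List ℕ)} (hT : IsTableau T)
    (hT' : IsTableau T') (h : insertRow x T = insertRow x' T')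
    (e : tableauInsert x T = tableauInsert x' T') : x = x' ∧ T = T' := by
  induction T generalizing x x' T' with
  | nil =>
    cases T' with
    | nil => simpa [tableauInsert] using e
    | cons r' rs' =>
      -- Nonempty rows exclude `[[]]`, into which an insertion would also give a single cell.
      have h0 := hT'.1
      rw [insertRow, insertRow] at h
      rw [tableauInsert, tableauInsert] at e
      split at h
      · rename_i h'
        simp only [h', rowInsert_snd_eq_none h'] at e
        cases r' <;> simp_all
      · omega
  | cons r rs ih =>
    cases T' with
    | nil =>
      have h0 := hT.1
      rw [insertRow, insertRow] at h
      rw [tableauInsert, tableauInsert] at e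
      split at h
      · rename_i h'
        simp only [h', rowInsert_snd_eq_none h'] at e
        cases r <;> simp_all
      · omega
    | cons r' rs' =>
      obtain ⟨-, h2, -, h4⟩ := hT
      obtain ⟨-, h2', -, h4'⟩ := hT'
      rw [insertRow, insertRow] at h
      rw [tableauInsert, tableauInsert] at e
      cases h1 : (rowInsert x r).2 with
      | none =>
        cases h1' : (rowInsert x' r').2 with
        | none =>
          simp only [h1, h1', rowInsert_snd_eq_none h1, rowInsert_snd_eq_none h1',
            List.cons.injEq] at e
          have := List.append_inj' e.1 rfl
          simp_all
        | some y' => simp [h1, h1'] at h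
      | some y =>
        cases h1' : (rowInsert x' r').2 with
        | none => simp [h1, h1'] at h
        | some y' =>
          simp only [h1, h1', List.cons.injEq, Nat.add_right_cancel_iff] at e h
          obtain ⟨rfl, rfl⟩ := ih h4 h4' h e.2
          obtain ⟨rfl, rfl⟩ := rowInsert_injective h2 h2' h1 h1' e.1
          exact ⟨rfl, rfl⟩

/-- Put `k` at the end of the row `i` of a tableau. -/
def appendAt (k : ℕ) : ℕ → List (List ℕ) → List (List ℕ)
  | 0, [] => [[k]]
  | 0, r :: rs => (r ++ [k]) :: rs
  | _ + 1, [] => []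
  | i + 1, r :: rs => r :: appendAt k i rs

theorem insertRow_le (x : ℕ) (T : List (List ℕ)) : insertRow x T ≤ T.length := by
  induction T generalizing x with
  | nil => simp [insertRow]
  | cons r rs ih =>
    rw [insertRow]
    split
    · simp
    · simpa using ih _

theorem map_length_appendAt_insertRow (x k : ℕ) (T Q : List (List ℕ))
    (h : Q.map List.length = T.map List.length) :
    (appendAt k (insertRow x T) Q).map List.length = (tableauInsert x T).map List.length := by
  induction T generalizing x Q with
  | nil =>
    have : Q = [] := by simpa using h
    subst this
    simp [insertRow, appendAt, tableauInsert]
  | cons r rs ih =>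
    cases Q with
    | nil => simp at h
    | cons q qs =>
      simp only [List.map_cons, List.cons.injEq] at h
      have hl := length_rowInsert x r
      rw [insertRow, tableauInsert]
      cases h' : (rowInsert x r).2 with
      | none =>
        simp [h'] at hl
        simp [appendAt, h, hl]
      | some y =>
        simp [h'] at hl
        simp only [appendAt, List.map_cons, h.1, hl, ih y qs h.2]

/-- The new entry `k` occurs only once, so its place is visible; as rows are nonempty, a new row is
not confused with an extended one. -/
theorem appendAt_injective {k i i' : ℕ} {Q Q' : List (List ℕ)} (hQ : ∀ q ∈ Q, q ≠ [] ∧ k ∉ q)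
    (hQ' : ∀ q ∈ Q', q ≠ [] ∧ k ∉ q) (hi : i ≤ Q.length) (hi' : i' ≤ Q'.length)
    (e : appendAt k i Q = appendAt k i' Q') : i = i' ∧ Q = Q' := by
  induction Q generalizing Q' i i' with
  | nil =>
    obtain rfl : i = 0 := by simpa using hi
    rcases Q' with _ | ⟨q', qs'⟩ <;> rcases i' with _ | i' <;> simp [appendAt] at e hi' ⊢
    · have := hQ' q' (by simp)
      grind
    · have := hQ' q' (by simp)
      grind
  | cons q qs ih =>
    have h0 := hQ q (by simp)
    rcases Q' with _ | ⟨q', qs'⟩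
    · obtain rfl : i' = 0 := by simpa using hi'
      rcases i with _ | i <;> simp [appendAt] at e
      · grind
      · grind
    · have h0' := hQ' q' (by simp)
      rcases i with _ | i <;> rcases i' with _ | i' <;> simp only [appendAt, List.cons.injEq] at e
      · have := List.append_inj' e.1 rfl
        simp_all
      · grind
      · grind
      · have := ih (fun q hq => hQ q (by simp [hq])) (fun q hq => hQ' q (by simp [hq]))
          (by simpa using hi) (by simpa using hi') e.2
        simp_all

theorem ColLT.length_le {r s : List ℕ} (h : ColLT r s) : s.length ≤ r.length := by
  induction r generalizing s with
  | nil =>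
    cases s with
    | nil => simp
    | cons b bs => exact h.elim
  | cons a as ih =>
    cases s with
    | nil => simp
    | cons b bs => simpa using ih h.2

theorem ColLT.append_left {r s : List ℕ} (h : ColLT r s) (u : List ℕ) : ColLT (r ++ u) s := by
  induction r generalizing s with
  | nil =>
    cases s with
    | nil => exact colLT_nil _
    | cons b bs => exact h.elim
  | cons a as ih =>
    cases s with
    | nil => exact colLT_nil _
    | cons b bs => exact ⟨h.1, ih h.2⟩

theorem ColLT.append_singleton {r s : List ℕ} (h : ColLT r s) {k : ℕ} (hk : ∀ a ∈ r, a < k)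
    (hl : s.length < r.length) : ColLT r (s ++ [k]) := by
  induction r generalizing s with
  | nil => simp at hl
  | cons a as ih =>
    cases s with
    | nil => exact ⟨hk a (by simp), colLT_nil _⟩
    | cons b bs =>
      exact ⟨h.1, ih h.2 (fun c hc => hk c (by simp [hc])) (by simpa using hl)⟩

theorem IsTableau.isChain_length {T : List (List ℕ)} (hT : IsTableau T) :
    (T.map List.length).IsChain (· ≥ ·) := by
  induction T with
  | nil => simp
  | cons r rs ih =>
    obtain ⟨-, -, h3, h4⟩ := hT
    cases rs with
    | nil => simp
    | cons r' rs' =>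
      simp only [List.map_cons, List.isChain_cons_cons]
      exact ⟨h3.length_le, ih h4⟩

/-- Being larger than all other entries, `k` can only violate the shape, and the condition on the
lengths ensures that a cell lies above it. -/
theorem IsTableau.appendAt {Q : List (List ℕ)} (hQ : IsTableau Q) {k : ℕ}
    (hk : ∀ q ∈ Q, ∀ a ∈ q, a < k) (i : ℕ)
    (hl : ((appendAt k i Q).map List.length).IsChain (· ≥ ·)) : IsTableau (appendAt k i Q) := by
  induction Q generalizing i with
  | nil => cases i <;> simp [RobinsonSchensted.appendAt, IsTableau, colLT_nil]
  | cons q qs ih =>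
    obtain ⟨h1, h2, h3, h4⟩ := hQ
    cases i with
    | zero =>
      refine ⟨by simp, ?_, h3.append_left _, h4⟩
      rw [List.pairwise_append]
      refine ⟨h2, by simp, fun a ha b hb => ?_⟩
      rw [List.mem_singleton] at hb
      exact hb ▸ (hk q (by simp) a ha).le
    | succ i =>
      rw [RobinsonSchensted.appendAt] at hl ⊢
      rw [List.map_cons] at hl
      refine ⟨h1, h2, ?_, ih h4 (fun q hq => hk q (by simp [hq])) i hl.tail⟩
      have hq : ∀ a ∈ q, a < k := hk q (by simp)
      cases qs with
      | nil =>
        cases i with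
        | zero => exact ColLT.append_singleton (s := []) h3 hq (List.length_pos_of_ne_nil h1)
        | succ i => exact colLT_nil _
      | cons q' qs' =>
        cases i with
        | zero =>
          refine h3.append_singleton hq ?_
          simp [RobinsonSchensted.appendAt] at hl
          simp
          omega
        | succ i => exact h3

theorem flatten_appendAt_perm {k i : ℕ} {Q : List (List ℕ)} (hi : i ≤ Q.length) :
    (appendAt k i Q).flatten.Perm (k :: Q.flatten) := by
  induction Q generalizing i with
  | nil =>
    obtain rfl : i = 0 := by simpa using hi
    simp [appendAt]
  | cons q qs ih =>
    cases i with
    | zero => simp [appendAt]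
    | succ i =>
      simp only [appendAt, List.flatten_cons]
      exact ((ih (by simpa using hi)).append_left q).trans List.perm_middle

/-- The recording tableau of a word, given in reverse order: the row that gets longer by the
insertion of the letter number `k` is extended by `k`. -/
def recordingRev : List ℕ → List (List ℕ)
  | [] => []
  | x :: w => appendAt w.length (insertRow x (insertionTableau w.reverse)) (recordingRev w)

/-! ### The pair of tableaux of a word -/

theorem insertionTableau_append (w : List ℕ) (x : ℕ) :
    insertionTableau (w ++ [x]) = tableauInsert x (insertionTableau w) := by
  simp [insertionTableau]

theorem isTableau_insertionTableau (w : List ℕ) : IsTableau (insertionTableau w) := by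
  induction w using List.reverseRecOn with
  | nil => trivial
  | append_singleton w x ih =>
    rw [insertionTableau_append]
    exact ih.tableauInsert x

theorem insertionTableau_perm (w : List ℕ) : (insertionTableau w).flatten.Perm w := by
  induction w using List.reverseRecOn with
  | nil => simp [insertionTableau]
  | append_singleton w x ih =>
    rw [insertionTableau_append]
    exact (flatten_tableauInsert_perm _ _).trans ((ih.cons x).trans
      (List.perm_append_singleton x w).symm)

theorem map_length_recordingRev (w : List ℕ) :
    (recordingRev w).map List.length = (insertionTableau w.reverse).map List.length := by
  induction w with
  | nil => simp [recordingRev, insertionTableau]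
  | cons x w ih =>
    rw [List.reverse_cons, insertionTableau_append, recordingRev]
    exact map_length_appendAt_insertRow _ _ _ _ ih

theorem insertRow_le_length_recordingRev (x : ℕ) (w : List ℕ) :
    insertRow x (insertionTableau w.reverse) ≤ (recordingRev w).length := by
  have h := congrArg List.length (map_length_recordingRev w)
  rw [List.length_map, List.length_map] at h
  rw [h]
  exact insertRow_le _ _

theorem recordingRev_perm (w : List ℕ) :
    (recordingRev w).flatten.Perm (List.range w.length) := by
  induction w with
  | nil => simp [recordingRev]
  | cons x w ih =>
    rw [recordingRev, List.length_cons, List.range_succ]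
    exact (flatten_appendAt_perm (insertRow_le_length_recordingRev x w)).trans
      ((ih.cons _).trans (List.perm_append_singleton _ _).symm)

theorem lt_of_mem_recordingRev {w q : List ℕ} {a : ℕ} (hq : q ∈ recordingRev w) (ha : a ∈ q) :
    a < w.length :=
  List.mem_range.1 ((recordingRev_perm w).subset (List.mem_flatten.2 ⟨q, hq, ha⟩))

theorem isTableau_recordingRev (w : List ℕ) : IsTableau (recordingRev w) := by
  induction w with
  | nil => trivial
  | cons x w ih =>
    have h := map_length_recordingRev (x :: w)
    rw [recordingRev] at h ⊢
    refine ih.appendAt (fun q hq a ha => lt_of_mem_recordingRev hq ha) _ ?_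
    rw [h]
    exact (isTableau_insertionTableau _).isChain_length

theorem IsTableau.ne_nil {T : List (List ℕ)} (hT : IsTableau T) {r : List ℕ} (hr : r ∈ T) :
    r ≠ [] := by
  induction T with
  | nil => simp at hr
  | cons q qs ih =>
    rcases List.mem_cons.1 hr with rfl | h
    · exact hT.1
    · exact ih hT.2.2.2 h

/-- The largest entry of the recording tableau marks the row that grew last. This determines the
last letter and the two previous tableaux, so induction applies. Words are reversed so that the last
letter is the head of the list. -/
theorem eq_of_tableaux_eq {w w' : List ℕ} (hl : w.length = w'.length)
    (hP : insertionTableau w.reverse = insertionTableau w'.reverse)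
    (hQ : recordingRev w = recordingRev w') : w = w' := by
  induction w generalizing w' with
  | nil => simpa using hl.symm
  | cons x w ih =>
    cases w' with
    | nil => simp at hl
    | cons x' w' =>
      simp only [List.length_cons, Nat.add_right_cancel_iff] at hl
      simp only [List.reverse_cons, insertionTableau_append] at hP
      rw [recordingRev, recordingRev, hl] at hQ
      have hn : ∀ v : List ℕ, v.length = w'.length →
          ∀ q ∈ recordingRev v, q ≠ [] ∧ w'.length ∉ q := fun v hv q hq =>
        ⟨(isTableau_recordingRev v).ne_nil hq,
          fun h => absurd (lt_of_mem_recordingRev hq h) (by omega)⟩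
      obtain ⟨hi, hQ'⟩ := appendAt_injective (hn w hl) (hn w' rfl)
        (insertRow_le_length_recordingRev x w) (insertRow_le_length_recordingRev x' w') hQ
      obtain ⟨rfl, hP'⟩ := tableauInsert_injective (isTableau_insertionTableau _)
        (isTableau_insertionTableau _) hi hP
      rw [ih hl hP' hQ']

end RobinsonSchensted

/-! ## The Robinson–Schensted map is injective -/

namespace RobinsonSchensted

theorem ColLT.trans {r s t : List ℕ} (h : ColLT r s) (h' : ColLT s t) : ColLT r t := by
  induction r generalizing s t with
  | nil =>
    cases s with
    | nil => exact h'
    | cons b bs => exact h.elim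
  | cons a as ih =>
    cases t with
    | nil => exact colLT_nil _
    | cons c cs =>
      cases s with
      | nil => exact h'.elim
      | cons b bs => exact ⟨h.1.trans h'.1, ih h.2 h'.2⟩

theorem IsTableau.pairwise_colLT {T : List (List ℕ)} (hT : IsTableau T) : T.Pairwise ColLT := by
  induction T with
  | nil => simp
  | cons r rs ih =>
    obtain ⟨-, -, h3, h4⟩ := hT
    refine List.pairwise_cons.2 ⟨fun s hs => ?_, ih h4⟩
    have := ih h4
    cases rs with
    | nil => simp at hs
    | cons q qs =>
      rcases List.mem_cons.1 hs with rfl | hs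
      · exact h3
      · exact ColLT.trans h3 ((List.pairwise_cons.1 this).1 s hs)

theorem IsTableau.pairwise_le {T : List (List ℕ)} (hT : IsTableau T) {r : List ℕ} (hr : r ∈ T) :
    r.Pairwise (· ≤ ·) := by
  induction T with
  | nil => simp at hr
  | cons q qs ih =>
    rcases List.mem_cons.1 hr with rfl | h
    · exact hT.2.1
    · exact ih hT.2.2.2 h

theorem ColLT.getElem_lt {r s : List ℕ} (h : ColLT r s) {j : ℕ} (hj : j < s.length) :
    r[j]'(hj.trans_le h.length_le) < s[j] := by
  induction r generalizing s j with
  | nil =>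
    cases s with
    | nil => simp at hj
    | cons b bs => exact h.elim
  | cons a as ih =>
    cases s with
    | nil => simp at hj
    | cons b bs =>
      cases j with
      | zero => exact h.1
      | succ j => simpa using ih h.2 (by simpa using hj)

variable {n : ℕ}

/-- A list of rows whose row lengths are those of `l` has the cells of `l`. -/
theorem lt_length_of_mem_diagram {T : List (List ℕ)} {l : n.Partition}
    (hl : T.map List.length = l.rows) (c : l.diagram.cells) :
    ∃ h : c.1.1 < T.length, c.1.2 < T[c.1.1].length := by
  have h1 := (l.mem_diagram c.1).1 c.2
  rw [Nat.Partition.rowLen, ← hl] at h1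
  have h : c.1.1 < T.length := by
    by_contra h
    rw [List.getD_eq_default _ _ (by simpa using h)] at h1
    omega
  refine ⟨h, ?_⟩
  simpa [List.getD, h] using h1

theorem mem_diagram_of_lt_length {T : List (List ℕ)} {l : n.Partition}
    (hl : T.map List.length = l.rows) {i j : ℕ} (hi : i < T.length) (hj : j < T[i].length) :
    (i, j) ∈ l.diagram.cells := by
  rw [l.mem_diagram, Nat.Partition.rowLen, ← hl]
  simpa [List.getD, hi] using hj

/-- The entry of a list of rows at a cell. -/
def entry {T : List (List ℕ)} {l : n.Partition} (hl : T.map List.length = l.rows)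
    (c : l.diagram.cells) : ℕ :=
  (T[c.1.1]'(lt_length_of_mem_diagram hl c).1)[c.1.2]'(lt_length_of_mem_diagram hl c).2

theorem entry_lt {T : List (List ℕ)} {l : n.Partition} (hl : T.map List.length = l.rows)
    (hT : T.flatten.Perm (List.range n)) (c : l.diagram.cells) : entry hl c < n :=
  List.mem_range.1 (hT.subset (List.mem_flatten.2 ⟨_, List.getElem_mem _, List.getElem_mem _⟩))

theorem entry_bijective {T : List (List ℕ)} {l : n.Partition} (hl : T.map List.length = l.rows)
    (hT : T.flatten.Perm (List.range n)) :
    Function.Bijective fun c : l.diagram.cells => (⟨entry hl c, entry_lt hl hT c⟩ : Fin n) := by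
  constructor
  · intro c d h
    have h : entry hl c = entry hl d := congrArg Fin.val h
    have hn := List.nodup_flatten.1 (hT.nodup_iff.2 List.nodup_range)
    obtain ⟨hc, hc'⟩ := lt_length_of_mem_diagram hl c
    obtain ⟨hd, hd'⟩ := lt_length_of_mem_diagram hl d
    have key : c.1.1 = d.1.1 := by
      rw [List.pairwise_iff_getElem] at hn
      by_contra hne
      rcases lt_or_gt_of_ne hne with hlt | hlt
      · exact hn.2 _ _ hc hd hlt (List.getElem_mem hc')
          (Eq.subst (motive := (· ∈ T[d.1.1])) h.symm (List.getElem_mem hd'))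
      · exact hn.2 _ _ hd hc hlt (List.getElem_mem hd')
          (Eq.subst (motive := (· ∈ T[c.1.1])) h (List.getElem_mem hc'))
    obtain ⟨⟨i, j⟩, hc0⟩ := c
    obtain ⟨⟨i', j'⟩, hd0⟩ := d
    obtain rfl : i = i' := key
    have : j = j' := ((hn.1 _ (List.getElem_mem hc)).getElem_inj_iff).1 h
    subst this
    rfl
  · intro v
    obtain ⟨r, hr, hv⟩ := List.mem_flatten.1 (hT.symm.subset (List.mem_range.2 v.2))
    obtain ⟨i, hi, rfl⟩ := List.getElem_of_mem hr
    obtain ⟨j, hj, hv⟩ := List.getElem_of_mem hv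
    exact ⟨⟨(i, j), mem_diagram_of_lt_length hl hi hj⟩, Fin.ext hv⟩

/-- The standard tableau given by a list of rows. -/
noncomputable def toStandardTableau {T : List (List ℕ)} {l : n.Partition} (h : IsTableau T)
    (hl : T.map List.length = l.rows) (hT : T.flatten.Perm (List.range n)) : l.StandardTableau :=
  ⟨Equiv.ofBijective _ (entry_bijective hl hT), by
    constructor
    · intro c d h1 h2
      refine lt_of_le_of_ne ?_ fun e => ?_
      · change entry hl c ≤ entry hl d
        obtain ⟨⟨i, j⟩, hc0⟩ := c
        obtain ⟨⟨i', j'⟩, hd0⟩ := d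
        obtain rfl : i = i' := h1
        exact List.pairwise_iff_getElem.1 (h.pairwise_le (List.getElem_mem _)) _ _ _ _ h2
      · have := (Equiv.injective _) e
        subst this
        exact lt_irrefl _ h2
    · intro c d h1 h2
      change entry hl c < entry hl d
      obtain ⟨⟨i, j⟩, hc0⟩ := c
      obtain ⟨⟨i', j'⟩, hd0⟩ := d
      obtain rfl : j = j' := h1
      exact ColLT.getElem_lt (List.pairwise_iff_getElem.1 h.pairwise_colLT _ _ _ _ h2) _⟩

theorem eq_of_toStandardTableau_eq {T T' : List (List ℕ)} {l : n.Partition} (h : IsTableau T)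
    (h' : IsTableau T') (hl : T.map List.length = l.rows) (hl' : T'.map List.length = l.rows)
    (hT : T.flatten.Perm (List.range n)) (hT' : T'.flatten.Perm (List.range n))
    (e : toStandardTableau h hl hT = toStandardTableau h' hl' hT') : T = T' := by
  have e' : ∀ c, entry hl c = entry hl' c := fun c =>
    congrArg Fin.val (congrArg (fun S : l.StandardTableau => S.1 c) e)
  have hlen : T.map List.length = T'.map List.length := hl.trans hl'.symm
  refine List.ext_getElem (by simpa using congrArg List.length hlen) fun i hi hi' => ?_
  refine List.ext_getElem ?_ fun j hj hj' => ?_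
  · have := List.getElem_of_eq hlen (i := i) (by simpa using hi)
    simpa using this
  · exact e' ⟨(i, j), mem_diagram_of_lt_length hl hi hj⟩

theorem word_perm (σ : Equiv.Perm (Fin n)) : (word σ).Perm (List.range n) := by
  refine (List.perm_ext_iff_of_nodup ?_ List.nodup_range).2 fun a => ?_
  · exact List.nodup_ofFn.2 (Fin.val_injective.comp σ.injective)
  · rw [word, List.mem_ofFn, List.mem_range]
    constructor
    · rintro ⟨i, rfl⟩
      exact (σ i).2
    · intro h
      exact ⟨σ.symm ⟨a, h⟩, by simp⟩

theorem word_injective : Function.Injective (word : Equiv.Perm (Fin n) → List ℕ) := by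
  intro σ τ h
  have := List.ofFn_injective h
  exact Equiv.ext fun i => Fin.ext (congrFun this i)

theorem rows_shape (σ : Equiv.Perm (Fin n)) :
    (insertionTableau (word σ)).map List.length = (shape σ).rows := by
  have hT := isTableau_insertionTableau (word σ)
  rw [shape, Nat.Partition.rows_ofSums _ (List.isChain_iff_pairwise.1 hT.isChain_length)]
  symm
  rw [List.filter_eq_self]
  intro a ha
  obtain ⟨r, hr, rfl⟩ := List.mem_map.1 ha
  simpa using hT.ne_nil hr

theorem rows_recordingRev (σ : Equiv.Perm (Fin n)) :
    (recordingRev (word σ).reverse).map List.length = (shape σ).rows := by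
  rw [map_length_recordingRev, List.reverse_reverse, rows_shape]

theorem recordingRev_word_perm (σ : Equiv.Perm (Fin n)) :
    (recordingRev (word σ).reverse).flatten.Perm (List.range n) := by
  have := recordingRev_perm (word σ).reverse
  simpa [word] using this

/-- The insertion tableau and the recording tableau of a permutation. -/
noncomputable def tableaux {l : n.Partition} (σ : {σ : Equiv.Perm (Fin n) // shape σ = l}) :
    l.StandardTableau × l.StandardTableau :=
  (toStandardTableau (isTableau_insertionTableau (word σ.1)) ((rows_shape σ.1).trans (congrArg _ σ.2))
      ((insertionTableau_perm _).trans (word_perm σ.1)),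
    toStandardTableau (isTableau_recordingRev (word σ.1).reverse) ((rows_recordingRev σ.1).trans (congrArg _ σ.2))
      (recordingRev_word_perm σ.1))

theorem tableaux_injective (l : n.Partition) :
    Function.Injective (tableaux : {σ : Equiv.Perm (Fin n) // shape σ = l} → _) := by
  intro σ τ h
  rw [tableaux, tableaux, Prod.mk.injEq] at h
  have h1 := eq_of_toStandardTableau_eq _ _ _ _ _ _ h.1
  have h2 := eq_of_toStandardTableau_eq _ _ _ _ _ _ h.2
  refine Subtype.ext (word_injective (List.reverse_injective ?_))
  exact eq_of_tableaux_eq (by simp [word]) (by simpa using h1) h2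

instance (l : n.Partition) : Finite l.StandardTableau :=
  inferInstanceAs (Finite (Subtype _))

/-- Only injectivity of the correspondence enters; equality comes later, from the independence of
the row sums, in `SymGroupAlgebra.card_shape_eq`. -/
theorem card_shape_le (l : n.Partition) :
    Nat.card {σ : Equiv.Perm (Fin n) // shape σ = l} ≤ l.numStandard ^ 2 := by
  rw [Nat.Partition.numStandard, sq, ← Nat.card_prod]
  exact Nat.card_le_card_of_injective _ (tableaux_injective l)

end RobinsonSchensted

/-! ## Colourings of words by decreasing subsequences -/

namespace RobinsonSchensted

/-- The sum of the sizes of the colour classes of `S`, each of them truncated at `k`. -/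
def weight (k : ℕ) (c : ℕ → ℕ) (S : Finset ℕ) : ℕ :=
  ∑ i ∈ S.image c, min (S.filter (c · = i)).card k

/-- Every colour class of the word is strictly decreasing. -/
def IsDecreasingColoring (c : ℕ → ℕ) (w : List ℕ) : Prop :=
  w.Pairwise fun a b => c a = c b → b < a

/-- The word can be coloured by decreasing classes so that the sum of the truncated class sizes
is at most `m`. -/
def HasDecreasingColoring (k m : ℕ) (w : List ℕ) : Prop :=
  ∃ c, IsDecreasingColoring c w ∧ weight k c w.toFinset ≤ m

theorem weight_eq_sum {k : ℕ} {c : ℕ → ℕ} {S J : Finset ℕ} (hJ : S.image c ⊆ J) :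
    weight k c S = ∑ i ∈ J, min (S.filter (c · = i)).card k := by
  refine Finset.sum_subset hJ fun i _ hi => ?_
  have : S.filter (c · = i) = ∅ := by
    rw [Finset.filter_eq_empty_iff]
    intro v hv h
    exact hi (Finset.mem_image.2 ⟨v, hv, h⟩)
  simp [this]

/-- Compare the weights of two colourings that differ only in the colours in `D`. -/
theorem weight_le_weight {k : ℕ} {c c' : ℕ → ℕ} {S : Finset ℕ} (D : Finset ℕ)
    (hD : ∀ v ∈ S, ∀ i ∉ D, c v = i ↔ c' v = i)
    (h : ∑ i ∈ D, min (S.filter (c' · = i)).card k ≤ ∑ i ∈ D, min (S.filter (c · = i)).card k) :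
    weight k c' S ≤ weight k c S := by
  set J := S.image c ∪ S.image c' ∪ D with hJ
  have h1 : S.image c ⊆ J := fun i hi => by simp [hJ, -Finset.mem_image, hi]
  have h2 : S.image c' ⊆ J := fun i hi => by simp [hJ, -Finset.mem_image, hi]
  have h3 : D ⊆ J := fun i hi => by simp [hJ, -Finset.mem_image, hi]
  rw [weight_eq_sum h1, weight_eq_sum h2, ← Finset.sum_sdiff h3, ← Finset.sum_sdiff h3]
  refine add_le_add (le_of_eq (Finset.sum_congr rfl fun i hi => ?_)) h
  rw [Finset.filter_congr fun v hv => (hD v hv i (Finset.mem_sdiff.1 hi).2).symm]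

/-- The ascent `x z` forces different colours on `x` and `z`, so the same colouring survives the
exchange. -/
theorem HasDecreasingColoring.swap_lt {k m x z : ℕ} {u v : List ℕ} (hxz : x < z)
    (h : HasDecreasingColoring k m (u ++ x :: z :: v)) :
    HasDecreasingColoring k m (u ++ z :: x :: v) := by
  obtain ⟨c, h1, h2⟩ := h
  refine ⟨c, ?_, ?_⟩
  · simp only [IsDecreasingColoring, List.pairwise_append, List.pairwise_cons,
      List.mem_cons] at h1 ⊢
    grind
  · have : (u ++ z :: x :: v).toFinset = (u ++ x :: z :: v).toFinset := by
      ext; simp; tauto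
    rwa [this]

/-- The conditions on a colouring `c'` under which it may replace a colouring `c` after the
exchange of the letters `z` and `x`. -/
theorem IsDecreasingColoring.swap {c c' : ℕ → ℕ} {x y z : ℕ} {u v : List ℕ} (hyz : y < z)
    (h : IsDecreasingColoring c (u ++ z :: x :: y :: v))
    (H : (∀ a ∈ u, (c a = c z → z < a) ∧ (c a = c x → x < a) ∧ (c a = c y → y < a)) →
      (∀ b ∈ v, (c z = c b → b < z) ∧ (c x = c b → b < x) ∧ (c y = c b → b < y)) →
      (∀ a ∈ u, ∀ b ∈ v, c a = c b → b < a) →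
      (c' x ≠ c' z ∧ c' x ≠ c' y) ∧
      (∀ a ∈ u, (c' a = c' z → z < a) ∧ (c' a = c' x → x < a) ∧ (c' a = c' y → y < a)) ∧
      (∀ b ∈ v, (c' z = c' b → b < z) ∧ (c' x = c' b → b < x) ∧ (c' y = c' b → b < y)) ∧
      (∀ a ∈ u, ∀ b ∈ v, c' a = c' b → b < a) ∧
      (∀ a ∈ u, ∀ b ∈ u, (c a = c b → b < a) → c' a = c' b → b < a) ∧
      (∀ a ∈ v, ∀ b ∈ v, (c a = c b → b < a) → c' a = c' b → b < a)) :
    IsDecreasingColoring c' (u ++ x :: z :: y :: v) := by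
  simp only [IsDecreasingColoring, List.pairwise_append, List.pairwise_cons, List.mem_cons,
    forall_eq_or_imp] at h ⊢
  obtain ⟨h1, ⟨⟨h2, h3, h4⟩, ⟨h5, h6⟩, h7, h8⟩, h9⟩ := h
  obtain ⟨k1, k2, k3, k4, k5, k6⟩ := H (fun a ha => ⟨(h9 a ha).1, (h9 a ha).2.1, (h9 a ha).2.2.1⟩)
    (fun b hb => ⟨h4 b hb, h6 b hb, h7 b hb⟩) (fun a ha => (h9 a ha).2.2.2)
  exact ⟨h1.imp_of_mem fun ha hb => k5 _ ha _ hb,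
    ⟨⟨fun e => (k1.1 e).elim, fun e => (k1.2 e).elim, fun b hb => (k3 b hb).2.1⟩,
      ⟨fun _ => hyz, fun b hb => (k3 b hb).1⟩, fun b hb => (k3 b hb).2.2,
      h8.imp_of_mem fun ha hb => k6 _ ha _ hb⟩,
    fun a ha => ⟨(k2 a ha).2.1, (k2 a ha).1, (k2 a ha).2.2, k4 a ha⟩⟩

/-- After the exchange, `x` gets a colour of its own. -/
theorem IsDecreasingColoring.swap_update {c : ℕ → ℕ} {x y z f : ℕ} {u v : List ℕ}
    (hxy : x < y) (hyz : y < z) (h : IsDecreasingColoring c (u ++ z :: x :: y :: v))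
    (hf : ∀ a ∈ u ++ z :: x :: y :: v, c a ≠ f) :
    IsDecreasingColoring (Function.update c x f) (u ++ x :: z :: y :: v) := by
  simp only [List.mem_append, List.mem_cons] at hf
  refine h.swap hyz fun h1 h2 h3 => ?_
  simp only [Function.update_apply]
  refine ⟨?_, ?_, ?_, ?_, ?_, ?_⟩
  all_goals grind

/-- After the exchange, `x` gets a colour of its own, and `y` gets the former colour of `x`. -/
theorem IsDecreasingColoring.swap_update_update {c : ℕ → ℕ} {x y z f : ℕ} {u v : List ℕ}
    (hxy : x < y) (hyz : y < z) (hc : c z = c x)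
    (h : IsDecreasingColoring c (u ++ z :: x :: y :: v))
    (hf : ∀ a ∈ u ++ z :: x :: y :: v, c a ≠ f) :
    IsDecreasingColoring (Function.update (Function.update c y (c x)) x f)
      (u ++ x :: z :: y :: v) := by
  simp only [List.mem_append, List.mem_cons] at hf
  refine h.swap hyz fun h1 h2 h3 => ?_
  simp only [Function.update_apply]
  refine ⟨?_, ?_, ?_, ?_, ?_, ?_⟩
  all_goals grind

/-- After the exchange, the tails of the colour classes of `x` and `y` change places. -/
theorem IsDecreasingColoring.swap_tails {c : ℕ → ℕ} {x y z : ℕ} {u v : List ℕ}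
    (hxy : x < y) (hyz : y < z) (hc : c z = c x) (hcy : c x ≠ c y)
    (h : IsDecreasingColoring c (u ++ z :: x :: y :: v)) :
    IsDecreasingColoring
      (fun a => if c a = c x ∧ a ≤ x then c y else if c a = c y ∧ a ≤ y then c x else c a)
      (u ++ x :: z :: y :: v) := by
  refine h.swap hyz fun h1 h2 h3 => ?_
  have hu : ∀ a ∈ u, (c a = c x → x < a) ∧ (c a = c y → y < a) := fun a ha => (h1 a ha).2
  have hv : ∀ a ∈ v, (c a = c x → a < x) ∧ (c a = c y → a < y) := fun a ha =>
    ⟨fun e => (h2 a ha).2.1 e.symm, fun e => (h2 a ha).2.2 e.symm⟩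
  -- Letters of the two classes that come before the exchanged ones are too large to lie in a tail;
  -- those that come after all lie in the tails.
  have eu : ∀ a ∈ u, (if c a = c x ∧ a ≤ x then c y else if c a = c y ∧ a ≤ y then c x else c a)
      = c a := fun a ha => by grind
  have ev : ∀ a ∈ v, (if c a = c x ∧ a ≤ x then c y else if c a = c y ∧ a ≤ y then c x else c a)
      = if c a = c x then c y else if c a = c y then c x else c a := fun a ha => by grind
  refine ⟨by grind, ?_, ?_, ?_, ?_, ?_⟩
  · intro a ha
    rw [eu a ha]
    grind
  · intro b hb
    rw [ev b hb]
    grind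
  · intro a ha b hb
    rw [eu a ha, ev b hb]
    grind
  · intro a ha b hb
    rw [eu a ha, eu b hb]
    exact id
  · intro a ha b hb
    rw [ev a ha, ev b hb]
    grind

/-- The Knuth move `z x y` to `x z y`. A colouring fails only if `z` and `x` share a colour; then
`y` has another one, as `x y` is an ascent. The repair depends on which of the classes of `x` and
`y` have more than `k` elements. -/
theorem HasDecreasingColoring.swap_gt {k m x y z : ℕ} {u v : List ℕ} (hxy : x < y) (hyz : y < z)
    (h : HasDecreasingColoring k m (u ++ z :: x :: y :: v)) :
    HasDecreasingColoring k m (u ++ x :: z :: y :: v) := by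
  obtain ⟨c, h1, h2⟩ := h
  set S := (u ++ z :: x :: y :: v).toFinset with hS
  have hS' : (u ++ x :: z :: y :: v).toFinset = S := by
    ext; simp [hS]; tauto
  have hxS : x ∈ S := by simp [hS]
  have hyS : y ∈ S := by simp [hS]
  have hzS : z ∈ S := by simp [hS]
  unfold HasDecreasingColoring
  rw [hS']
  by_cases hc : c z = c x
  swap
  · refine ⟨c, ?_, h2⟩
    simp only [IsDecreasingColoring, List.pairwise_append, List.pairwise_cons,
      List.mem_cons] at h1 ⊢
    grind
  have hcy : c x ≠ c y := by
    simp only [IsDecreasingColoring, List.pairwise_append, List.pairwise_cons,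
      List.mem_cons] at h1
    grind
  obtain ⟨f, hf⟩ := Infinite.exists_notMem_finset (S.image c)
  have hf' : ∀ a ∈ S, c a ≠ f := fun a ha e => hf (Finset.mem_image.2 ⟨a, ha, e⟩)
  have hf'' : ∀ a ∈ u ++ z :: x :: y :: v, c a ≠ f := fun a ha =>
    hf' a (List.mem_toFinset.2 ha)
  clear_value S
  have hfx := hf' x hxS
  have hfy := hf' y hyS
  have hfz := hf' z hzS
  have hzx : z ∈ S.filter (c · = c x) := by simp [hzS, hc]
  have hxx : x ∈ S.filter (c · = c x) := by simp [hxS]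
  have hyy : y ∈ S.filter (c · = c y) := by simp [hyS]
  have hf0 : S.filter (c · = f) = ∅ := by
    rw [Finset.filter_eq_empty_iff]
    exact hf'
  have two : 2 ≤ (S.filter (c · = c x)).card := by
    refine Finset.one_lt_card.2 ⟨z, hzx, x, hxx, by omega⟩
  have one : 1 ≤ (S.filter (c · = c y)).card := Finset.card_pos.2 ⟨y, hyy⟩
  -- The class of `x` is not truncated, so splitting off `x` as a class of its own does not change
  -- the weight.
  by_cases hC : (S.filter (c · = c x)).card ≤ k
  · refine ⟨Function.update c x f, ?_, le_trans (weight_le_weight {c x, f} ?_ ?_) h2⟩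
    · exact h1.swap_update hxy hyz hf''
    · intro a ha i hi
      simp only [Finset.mem_insert, Finset.mem_singleton, not_or] at hi
      by_cases hax : a = x
      · subst hax
        simp only [Function.update_self]
        grind
      · simp [hax]
    · have e1 : S.filter (Function.update c x f · = c x) = (S.filter (c · = c x)).erase x := by
        ext a
        simp only [Finset.mem_filter, Finset.mem_erase, Function.update_apply]
        grind
      have e2 : S.filter (Function.update c x f · = f) = {x} := by
        ext a
        simp only [Finset.mem_filter, Finset.mem_singleton, Function.update_apply]
        grind
      rw [Finset.sum_pair hfx, Finset.sum_pair hfx, e1, e2, hf0, Finset.card_erase_of_mem hxx]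
      simp only [Finset.card_singleton, Finset.card_empty]
      omega
  -- Here `y` replaces `x` in the class of `x`, whose size stays the same; the class of `y` loses
  -- the 1 that the new class `{x}` gains.
  by_cases hC' : (S.filter (c · = c y)).card ≤ k
  · refine ⟨Function.update (Function.update c y (c x)) x f, ?_,
      le_trans (weight_le_weight {c x, c y, f} ?_ ?_) h2⟩
    · exact h1.swap_update_update hxy hyz hc hf''
    · intro a ha i hi
      simp only [Finset.mem_insert, Finset.mem_singleton, not_or] at hi
      simp only [Function.update_apply]
      grind
    · have e1 : S.filter (Function.update (Function.update c y (c x)) x f · = c x)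
          = insert y ((S.filter (c · = c x)).erase x) := by
        ext a
        simp only [Finset.mem_filter, Finset.mem_erase, Finset.mem_insert, Function.update_apply]
        grind
      have e2 : S.filter (Function.update (Function.update c y (c x)) x f · = c y)
          = (S.filter (c · = c y)).erase y := by
        ext a
        simp only [Finset.mem_filter, Finset.mem_erase, Function.update_apply]
        grind
      have e3 : S.filter (Function.update (Function.update c y (c x)) x f · = f) = {x} := by
        ext a
        simp only [Finset.mem_filter, Finset.mem_singleton, Function.update_apply]
        grind
      have hn1 : c x ∉ ({c y, f} : Finset ℕ) := by simp [hcy, hfx]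
      rw [Finset.sum_insert hn1, Finset.sum_insert hn1, Finset.sum_pair hfy, Finset.sum_pair hfy,
        e1, e2, e3, hf0, Finset.card_erase_of_mem hyy,
        Finset.card_insert_of_notMem (by simp [hcy.symm]), Finset.card_erase_of_mem hxx]
      simp only [Finset.card_singleton, Finset.card_empty]
      omega
  -- Both classes already contribute the maximal value `k`, so exchanging their tails cannot
  -- increase the weight.
  · refine ⟨fun a => if c a = c x ∧ a ≤ x then c y else if c a = c y ∧ a ≤ y then c x else c a, ?_,
      le_trans (weight_le_weight {c x, c y} ?_ ?_) h2⟩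
    · exact h1.swap_tails hxy hyz hc hcy
    · intro a ha i hi
      simp only [Finset.mem_insert, Finset.mem_singleton, not_or] at hi
      grind
    · rw [Finset.sum_pair hcy, Finset.sum_pair hcy]
      omega

/-! ### Colourings carried back along insertion -/

theorem HasDecreasingColoring.move_right {k m x : ℕ} {s : List ℕ} (hs : ∀ a ∈ s, x < a)
    {u v : List ℕ} (h : HasDecreasingColoring k m (u ++ x :: (s ++ v))) :
    HasDecreasingColoring k m (u ++ (s ++ x :: v)) := by
  induction s generalizing u with
  | nil => exact h
  | cons a s ih =>
    have h1 := h.swap_lt (hs a (by simp))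
    have := ih (fun b hb => hs b (by simp [hb])) (u := u ++ [a]) (by simpa using h1)
    simpa using this

/-- Knuth moves turn `y` followed by the new row into the old row followed by `x`: first `y` moves
right to its old place, then `x` moves right to the end. -/
theorem HasDecreasingColoring.of_rowInsert {k m x y : ℕ} {r : List ℕ} (hr : r.Pairwise (· ≤ ·))
    (hn : (x :: r).Nodup) (hy : (rowInsert x r).2 = some y) {u v : List ℕ}
    (h : HasDecreasingColoring k m (u ++ y :: ((rowInsert x r).1 ++ v))) :
    HasDecreasingColoring k m (u ++ (r ++ x :: v)) := by
  induction r generalizing u with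
  | nil => simp [rowInsert] at hy
  | cons a as ih =>
    rw [List.pairwise_cons] at hr
    by_cases hx : x < a
    · simp only [rowInsert, hx, if_true, Option.some.injEq] at hy h
      subst hy
      have := HasDecreasingColoring.move_right (u := u ++ [a]) (s := as) (x := x) (v := v)
        (k := k) (m := m) (fun b hb => hx.trans_le (hr.1 b hb)) (by simpa using h)
      simpa using this
    · have hs' := rowInsert_pairwise (x := x) hr.2
      have hm := self_mem_rowInsert x as
      have hmem := fun b => mem_rowInsert (x := x) (b := b) (r := as)
      simp only [rowInsert, hx, if_false] at hy h
      have hxy := (rowInsert_snd_eq_some hy).1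
      have ih' := ih hr.2 (by grind) hy (u := u ++ [a])
      suffices HasDecreasingColoring k m (u ++ a :: y :: ((rowInsert x as).1 ++ v)) by
        simpa using ih' (by simpa using this)
      obtain ⟨b, t, hbt⟩ := List.exists_cons_of_ne_nil (rowInsert_ne_nil x as)
      rw [hbt] at h hs' hm hmem ⊢
      rw [List.pairwise_cons] at hs'
      -- The bumped `y` passes `a` in front of the next entry `b`, where `a < b < y`; the bound `b ≤
      -- x` holds because `x` lies in the sorted row that begins with `b`.
      refine HasDecreasingColoring.swap_gt (y := b) ?_ ?_ h
      · have := hmem b (by simp)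
        have := hr.1 b
        grind
      · rcases List.mem_cons.1 hm with rfl | hm
        · exact hxy
        · exact (hs'.1 x hm).trans_lt hxy

/-- The row reading word of a tableau, from the bottom row to the top row. -/
def readingWord : List (List ℕ) → List ℕ
  | [] => []
  | r :: rs => readingWord rs ++ r

/-- Since lower rows are read first, the bumped letter stands right after the reading word of the
lower rows. Its insertion there is undone first, then that of `x` into the top row. -/
theorem HasDecreasingColoring.of_tableauInsert {k m x : ℕ} {T : List (List ℕ)} (hT : IsTableau T)
    (hn : (x :: T.flatten).Nodup) {v : List ℕ}
    (h : HasDecreasingColoring k m (readingWord (tableauInsert x T) ++ v)) :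
    HasDecreasingColoring k m (readingWord T ++ x :: v) := by
  induction T generalizing x v with
  | nil => simpa [tableauInsert, readingWord] using h
  | cons r rs ih =>
    obtain ⟨-, h2, -, h4⟩ := hT
    rw [tableauInsert] at h
    cases h' : (rowInsert x r).2 with
    | none =>
      simp only [h', rowInsert_snd_eq_none h'] at h
      simpa [readingWord] using h
    | some y =>
      simp only [h', readingWord] at h
      have hy := (rowInsert_snd_eq_some h').2
      have hn' : (x :: (r ++ rs.flatten)).Nodup := by simpa using hn
      have := ih h4 (x := y) (v := (rowInsert x r).1 ++ v) (by
        rw [List.nodup_cons, List.nodup_append] at hn'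
        rw [List.nodup_cons]
        exact ⟨fun hy' => hn'.2.2.2 y hy y hy' rfl, hn'.2.2.1⟩) (by simpa using h)
      have := HasDecreasingColoring.of_rowInsert h2
        (hn'.sublist (List.Sublist.cons_cons _ (List.sublist_append_left _ _))) h' this
      simpa [readingWord] using this

theorem HasDecreasingColoring.of_insertionTableau {k m : ℕ} {w : List ℕ} (hn : w.Nodup)
    {v : List ℕ} (h : HasDecreasingColoring k m (readingWord (insertionTableau w) ++ v)) :
    HasDecreasingColoring k m (w ++ v) := by
  induction w using List.reverseRecOn generalizing v with
  | nil => simpa [insertionTableau, readingWord] using h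
  | append_singleton w x ih =>
    rw [insertionTableau_append] at h
    have hn' : (x :: w).Nodup := (List.perm_append_singleton x w).nodup_iff.1 hn
    have := HasDecreasingColoring.of_tableauInsert (isTableau_insertionTableau w)
      (((insertionTableau_perm w).cons x).nodup_iff.2 hn') h
    simpa using ih hn'.of_cons this

/-- The index of the column of a tableau in which the entry `a` stands. -/
def colIdx : List (List ℕ) → ℕ → ℕ
  | [], _ => 0
  | r :: rs, a => if a ∈ r then r.idxOf a else colIdx rs a

theorem mem_readingWord {T : List (List ℕ)} {a : ℕ} : a ∈ readingWord T ↔ a ∈ T.flatten := by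
  induction T with
  | nil => simp [readingWord]
  | cons r rs ih => simp [readingWord, ih, or_comm]

theorem exists_getElem_colIdx {T : List (List ℕ)} {a : ℕ} (h : a ∈ T.flatten) :
    ∃ r ∈ T, ∃ h : colIdx T a < r.length, r[colIdx T a] = a := by
  induction T with
  | nil => simp at h
  | cons r rs ih =>
    rw [colIdx]
    split
    · rename_i ha
      exact ⟨r, by simp, List.idxOf_lt_length_iff.2 ha, by simp⟩
    · rename_i ha
      obtain ⟨s, hs, h1, h2⟩ := ih (by simpa [ha] using h)
      exact ⟨s, by simp [hs], h1, h2⟩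

/-- Columns are read from bottom to top, hence decreasingly. -/
theorem isDecreasingColoring_colIdx {T : List (List ℕ)} (hT : IsTableau T)
    (hn : T.flatten.Nodup) : IsDecreasingColoring (colIdx T) (readingWord T) := by
  induction T with
  | nil => simp [readingWord, IsDecreasingColoring]
  | cons r rs ih =>
    have hp := List.pairwise_cons.1 hT.pairwise_colLT
    rw [List.flatten_cons, List.nodup_append] at hn
    have hnot : ∀ a ∈ readingWord rs, a ∉ r := fun a ha ha' =>
      hn.2.2 a ha' a (mem_readingWord.1 ha) rfl
    refine List.pairwise_append.2 ⟨?_, ?_, ?_⟩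
    · refine (ih hT.2.2.2 hn.2.1).imp_of_mem fun {a b} ha hb h => ?_
      simpa only [colIdx, hnot a ha, hnot b hb, if_false] using h
    · refine hn.1.imp_of_mem fun {a b} ha hb hne h => (hne ?_).elim
      simp only [colIdx, ha, hb, if_true] at h
      exact (List.idxOf_inj ha).1 h
    · intro a ha b hb h
      simp only [colIdx, hnot a ha, hb, if_true, if_false] at h
      obtain ⟨s, hs, h1, h2⟩ := exists_getElem_colIdx (mem_readingWord.1 ha)
      have := (hp.1 s hs).getElem_lt h1
      rw [h2] at this
      simp only [h, List.getElem_idxOf] at this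
      exact this

/-- A column truncated at `k` is no larger than its part in the first `k` rows. The induction
removes the top row and lowers `k` by one. -/
theorem weight_colIdx_le {T : List (List ℕ)} (hT : IsTableau T) (hn : T.flatten.Nodup) (k : ℕ) :
    weight k (colIdx T) (readingWord T).toFinset ≤ ((T.map List.length).take k).sum := by
  induction T generalizing k with
  | nil => simp [readingWord, weight]
  | cons r rs ih =>
    have hp := List.pairwise_cons.1 hT.pairwise_colLT
    rw [List.flatten_cons, List.nodup_append] at hn
    have hnot : ∀ a ∈ readingWord rs, a ∉ r := fun a ha ha' =>
      hn.2.2 a ha' a (mem_readingWord.1 ha) rfl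
    cases k with
    | zero => simp [weight]
    | succ k =>
      set c := colIdx (r :: rs) with hc
      set S := (readingWord (r :: rs)).toFinset with hS
      set S' := (readingWord rs).toFinset with hS'
      have hSS : S = r.toFinset ∪ S' := by
        ext; simp [hS, hS', readingWord, or_comm]
      have hcc : ∀ a ∈ S', c a = colIdx rs a := fun a ha => by
        rw [hc, colIdx, if_neg (hnot a (by simpa [hS'] using ha))]
      have himg : S'.image (colIdx rs) ⊆ S.image c := by
        intro i hi
        obtain ⟨a, ha, rfl⟩ := Finset.mem_image.1 hi
        exact Finset.mem_image.2 ⟨a, by simp [hSS, ha], hcc a ha⟩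
      have hr : ∑ i ∈ S.image c, (r.toFinset.filter (c · = i)).card = r.length := by
        rw [← List.toFinset_card_of_nodup hn.1]
        refine (Finset.card_eq_sum_card_fiberwise fun a ha => ?_).symm
        exact Finset.mem_coe.2 (Finset.mem_image_of_mem c (by rw [hSS]; exact Finset.mem_union_left _ ha))
      rw [List.map_cons, List.take_succ_cons, List.sum_cons, ← hr]
      refine le_trans ?_ (Nat.add_le_add_left (ih hT.2.2.2 hn.2.1 k) _)
      rw [weight_eq_sum himg, weight, ← Finset.sum_add_distrib]
      refine Finset.sum_le_sum fun i _ => ?_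
      have h1 : (S.filter (c · = i)).card
          ≤ (r.toFinset.filter (c · = i)).card + (S'.filter (colIdx rs · = i)).card := by
        rw [hSS, Finset.filter_union, Finset.filter_congr (s := S') (q := (colIdx rs · = i))
          fun a ha => by rw [hcc a ha]]
        exact Finset.card_union_le _ _
      -- A column that occurs further down has a cell in the top row, which pays for the change from
      -- `k + 1` to `k`.
      have h2 : 0 < (S'.filter (colIdx rs · = i)).card →
          0 < (r.toFinset.filter (c · = i)).card := by
        intro h
        obtain ⟨a, ha⟩ := Finset.card_pos.1 h
        rw [Finset.mem_filter] at ha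
        obtain ⟨s, hs, h3, -⟩ := exists_getElem_colIdx
          (mem_readingWord.1 (List.mem_toFinset.1 ha.1))
        rw [ha.2] at h3
        have h4 := h3.trans_le (hp.1 s hs).length_le
        refine Finset.card_pos.2 ⟨r[i], ?_⟩
        simp [hc, colIdx, hn.1.idxOf_getElem]
      omega

/-- A permutation of shape `l` can be partitioned into decreasing subsequences such that the sum
of their lengths, truncated at `k`, is at most the sum of the first `k` parts of `l`. -/
theorem hasDecreasingColoring_word {n : ℕ} (σ : Equiv.Perm (Fin n)) (k : ℕ) :
    HasDecreasingColoring k ((shape σ).partialSum k) (word σ) := by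
  have hn : (word σ).Nodup := (word_perm σ).nodup_iff.2 List.nodup_range
  have hT := isTableau_insertionTableau (word σ)
  have hn' := (insertionTableau_perm (word σ)).nodup_iff.2 hn
  have := HasDecreasingColoring.of_insertionTableau (k := k) (m := (shape σ).partialSum k)
    (v := []) hn ⟨_, by simpa using isDecreasingColoring_colIdx hT hn', by
      rw [Nat.Partition.partialSum, ← rows_shape]
      simpa using weight_colIdx_le hT hn' k⟩
  simpa using this

end RobinsonSchensted

/-! ## Rows and columns of standard tableaux -/

namespace Nat.Partition

variable {n : ℕ} {l : n.Partition}

theorem exists_lt_partialSum (l : n.Partition) (v : Fin n) : ∃ k, (v : ℕ) < l.partialSum (k + 1) :=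
  ⟨n, by rw [l.partialSum_of_le (by omega)]; exact v.2⟩

/-- The index of the block of `l` that contains `v`. -/
def blockIdx (l : n.Partition) (v : Fin n) : ℕ := Nat.find (l.exists_lt_partialSum v)

theorem blockIdx_lt_iff (l : n.Partition) (v : Fin n) (k : ℕ) :
    l.blockIdx v < k ↔ (v : ℕ) < l.partialSum k := by
  rw [blockIdx, Nat.find_lt_iff]
  constructor
  · rintro ⟨m, hm, h⟩
    exact h.trans_le (l.partialSum_mono hm)
  · intro h
    cases k with
    | zero => simp [partialSum] at h
    | succ k => exact ⟨k, by omega, h⟩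

theorem mem_block_iff (l : n.Partition) (v : Fin n) (k : ℕ) :
    v ∈ l.block k ↔ l.blockIdx v = k := by
  have h1 := l.blockIdx_lt_iff v k
  have h2 := l.blockIdx_lt_iff v (k + 1)
  rw [block, Set.mem_ofPred_eq]
  omega

theorem mem_youngSubgroup_iff (l : n.Partition) (σ : Equiv.Perm (Fin n)) :
    σ ∈ l.youngSubgroup ↔ ∀ v, l.blockIdx (σ v) = l.blockIdx v := by
  change (∀ k i, σ i ∈ l.block k ↔ i ∈ l.block k) ↔ _
  simp only [mem_block_iff]
  exact ⟨fun h v => (h _ v).2 rfl, fun h k i => by rw [h]⟩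

theorem partialSum_le (l : n.Partition) (k : ℕ) : l.partialSum k ≤ n := by
  rcases le_total k n with h | h
  · exact (l.partialSum_mono h).trans (l.partialSum_of_le le_rfl).le
  · exact (l.partialSum_of_le h).le

theorem card_blockIdx_lt (l : n.Partition) (k : ℕ) :
    (Finset.univ.filter fun v => l.blockIdx v < k).card = l.partialSum k := by
  simp only [blockIdx_lt_iff]
  rw [Fin.card_filter_val_lt, min_eq_right (l.partialSum_le k)]

theorem card_filter_lt_succ {ι : Type*} [DecidableEq ι] (s : Finset ι) (f : ι → ℕ) (k : ℕ) :
    (s.filter fun v => f v < k + 1).card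
      = (s.filter fun v => f v < k).card + (s.filter fun v => f v = k).card := by
  rw [← Finset.card_union_of_disjoint]
  · congr 1
    ext v
    simp only [Finset.mem_filter, Finset.mem_union]
    grind
  · rw [Finset.disjoint_filter]
    intro v _ h
    omega

theorem card_filter_lt_eq_sum {ι : Type*} [DecidableEq ι] (s : Finset ι) (f : ι → ℕ) (k : ℕ) :
    (s.filter fun v => f v < k).card
      = ∑ i ∈ Finset.range k, (s.filter fun v => f v = i).card := by
  induction k with
  | zero => simp
  | succ k ih => rw [card_filter_lt_succ, Finset.sum_range_succ, ih]

theorem card_blockIdx_eq (l : n.Partition) (k : ℕ) :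
    (Finset.univ.filter fun v => l.blockIdx v = k).card = l.rowLen k := by
  have h := card_filter_lt_succ Finset.univ l.blockIdx k
  rw [card_blockIdx_lt, card_blockIdx_lt, partialSum_eq_sum, partialSum_eq_sum,
    Finset.sum_range_succ] at h
  omega

namespace StandardTableau

/-- The row of the entry `v`. -/
def row (t : l.StandardTableau) (v : Fin n) : ℕ := (t.1.symm v).1.1

/-- The column of the entry `v`. -/
def col (t : l.StandardTableau) (v : Fin n) : ℕ := (t.1.symm v).1.2

theorem col_lt_rowLen (t : l.StandardTableau) (v : Fin n) : t.col v < l.rowLen (t.row v) :=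
  (l.mem_diagram _).1 (t.1.symm v).2

theorem exists_entry (t : l.StandardTableau) {i j : ℕ} (h : j < l.rowLen i) :
    ∃ v, t.row v = i ∧ t.col v = j :=
  ⟨t.1 ⟨(i, j), (l.mem_diagram _).2 h⟩, by simp [row], by simp [col]⟩

theorem eq_of_row_col (t : l.StandardTableau) {u v : Fin n} (h : t.row u = t.row v)
    (h' : t.col u = t.col v) : u = v :=
  t.1.symm.injective (Subtype.ext (Prod.ext h h'))

theorem lt_of_row_eq (t : l.StandardTableau) {u v : Fin n} (h : t.row u = t.row v)
    (h' : t.col u < t.col v) : u < v := by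
  simpa using t.2.1 (t.1.symm u) (t.1.symm v) h h'

theorem lt_of_col_eq (t : l.StandardTableau) {u v : Fin n} (h : t.col u = t.col v)
    (h' : t.row u < t.row v) : u < v := by
  simpa using t.2.2 (t.1.symm u) (t.1.symm v) h h'

theorem card_row_eq (t : l.StandardTableau) (k : ℕ) :
    (Finset.univ.filter fun v => t.row v = k).card = l.rowLen k := by
  rw [← Finset.card_range (l.rowLen k)]
  refine Finset.card_nbij t.col ?_ ?_ ?_
  · intro v hv
    rw [Finset.mem_coe, Finset.mem_filter] at hv
    rw [Finset.mem_coe, Finset.mem_range, ← hv.2]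
    exact t.col_lt_rowLen v
  · intro u hu v hv h
    rw [Finset.mem_coe, Finset.mem_filter] at hu hv
    exact t.eq_of_row_col (hu.2.trans hv.2.symm) h
  · intro j hj
    rw [Finset.mem_coe, Finset.mem_range] at hj
    obtain ⟨v, h1, h2⟩ := t.exists_entry hj
    exact ⟨v, by simp [h1], h2⟩

theorem row_lt (t : l.StandardTableau) (v : Fin n) : t.row v < n := by
  by_contra h
  have h1 := t.col_lt_rowLen v
  rw [rowLen, List.getD_eq_default _ _ (l.length_rows_le.trans (not_lt.1 h))] at h1
  omega

/-- Rows increase, so a tableau is determined by the rows of its entries, as `row_injective` uses.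
-/
theorem col_eq_card (t : l.StandardTableau) (v : Fin n) :
    t.col v = (Finset.univ.filter fun u => t.row u = t.row v ∧ u < v).card := by
  rw [← Finset.card_range (t.col v)]
  symm
  refine Finset.card_nbij t.col ?_ ?_ ?_
  · intro u hu
    simp only [Finset.coe_filter, Finset.mem_univ, true_and, Set.mem_ofPred_eq] at hu
    rw [Finset.mem_coe, Finset.mem_range]
    by_contra h
    rcases (not_lt.1 h).eq_or_lt with h | h
    · exact hu.2.ne (t.eq_of_row_col hu.1 h.symm)
    · exact lt_asymm hu.2 (t.lt_of_row_eq hu.1.symm h)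
  · intro u hu v hv h
    simp only [Finset.coe_filter, Finset.mem_univ, true_and, Set.mem_ofPred_eq] at hu hv
    exact t.eq_of_row_col (hu.1.trans hv.1.symm) h
  · intro j hj
    rw [Finset.mem_coe, Finset.mem_range] at hj
    obtain ⟨u, h1, h2⟩ := t.exists_entry (hj.trans (t.col_lt_rowLen v))
    exact ⟨u, by simpa [h1] using t.lt_of_row_eq h1 (h2 ▸ hj), h2⟩

theorem row_injective {t t' : l.StandardTableau} (h : t.row = t'.row) : t = t' := by
  have hc : t.col = t'.col := funext fun v => by rw [col_eq_card, col_eq_card, h]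
  refine Subtype.ext (Equiv.symm_bijective.injective (Equiv.ext fun v => ?_))
  exact Subtype.ext (Prod.ext (congrFun h v) (congrFun hc v))

/-- The number of entries smaller than `m` in the first `k` rows. -/
def count (t : l.StandardTableau) (m k : ℕ) : ℕ :=
  (Finset.univ.filter fun v : Fin n => (v : ℕ) < m ∧ t.row v < k).card

/-- If a labelling takes different values on the entries of each column of `t`, then the labels
are at least as spread out as the rows of `t`. -/
theorem card_le_count (t : l.StandardTableau) (b : Fin n → ℕ)
    (hb : ∀ u v, u ≠ v → b u = b v → t.col u ≠ t.col v) (m k : ℕ) :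
    (Finset.univ.filter fun v : Fin n => (v : ℕ) < m ∧ b v < k).card ≤ t.count m k := by
  rw [count, Finset.card_eq_sum_card_fiberwise (f := t.col)
    (t := Finset.univ.image t.col) (fun v _ => by simp),
    Finset.card_eq_sum_card_fiberwise (f := t.col)
    (t := Finset.univ.image t.col) (fun v _ => by simp)]
  refine Finset.sum_le_sum fun j _ => ?_
  simp only [Finset.filter_filter]
  -- In a column whose entries below `m` all lie in the first `k` rows, the bound is clear.
  -- Otherwise its first `k` cells all carry entries below `m`, and at most `k` of its entries have
  -- labels below `k`, as labels in a column are distinct.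
  by_cases h : ∀ v : Fin n, (v : ℕ) < m → t.col v = j → t.row v < k
  · refine Finset.card_le_card fun v hv => ?_
    simp only [Finset.mem_filter, Finset.mem_univ, true_and] at hv ⊢
    exact ⟨⟨hv.1.1, h v hv.1.1 hv.2⟩, hv.2⟩
  · push Not at h
    obtain ⟨v, hv, rfl, hk⟩ := h
    trans k
    · conv_rhs => rw [← Finset.card_range k]
      refine Finset.card_le_card_of_injOn b ?_ ?_
      · intro u hu
        simp only [Finset.coe_filter, Finset.mem_univ, true_and, Set.mem_ofPred_eq] at hu
        simpa using hu.1.2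
      · intro u hu w hw huw
        simp only [Finset.coe_filter, Finset.mem_univ, true_and, Set.mem_ofPred_eq] at hu hw
        by_contra hne
        exact hb u w hne huw (hu.2.trans hw.2.symm)
    · conv_lhs => rw [← Finset.card_range k]
      refine Finset.card_le_card_of_surjOn t.row fun i hi => ?_
      rw [Finset.mem_coe, Finset.mem_range] at hi
      have h1 : (t.col v) < l.rowLen i := by
        rw [← lt_rowLen_conj]
        exact (hi.trans_le hk).trans ((lt_rowLen_conj _ _ _).2 (t.col_lt_rowLen v))
      obtain ⟨u, h2, h3⟩ := t.exists_entry h1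
      have h4 := t.lt_of_col_eq h3 (h2.trans_lt (hi.trans_le hk))
      refine ⟨u, ?_, h2⟩
      simp only [Finset.coe_filter, Finset.mem_univ, true_and, Set.mem_ofPred_eq, h2, h3]
      exact ⟨⟨lt_trans h4 hv, hi⟩, trivial⟩

theorem count_self (t : l.StandardTableau) (k : ℕ) : t.count n k = l.partialSum k := by
  have : ∀ v : Fin n, (v : ℕ) < n := fun v => v.2
  simp only [count, this, true_and]
  rw [partialSum_eq_sum, card_filter_lt_eq_sum]
  simp [card_row_eq]

/-- Passing from `v` to `v + 1` increases the count exactly when the row of `v` is below `k`. The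
shapes may differ a priori, so that this also separates tableaux of different shapes. -/
theorem row_eq_of_count_eq {l' : n.Partition} {t : l.StandardTableau} {t' : l'.StandardTableau}
    (h : ∀ m ≤ n, ∀ k ≤ n, t.count m k = t'.count m k) : t.row = t'.row := by
  have step : ∀ {l : n.Partition} (t : l.StandardTableau) (v : Fin n) (k : ℕ),
      t.count (v + 1) k = t.count v k + if t.row v < k then 1 else 0 := by
    intro l t v k
    rw [count, count]
    have : (Finset.univ.filter fun u : Fin n => (u : ℕ) < (v : ℕ) + 1 ∧ t.row u < k)
        = (Finset.univ.filter fun u : Fin n => (u : ℕ) < (v : ℕ) ∧ t.row u < k)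
          ∪ if t.row v < k then {v} else ∅ := by
      ext u
      have : (u : ℕ) < (v : ℕ) + 1 ↔ (u : ℕ) < v ∨ u = v := by
        rw [Fin.ext_iff]
        omega
      split
      · simp only [Finset.mem_filter, Finset.mem_univ, true_and, Finset.mem_union,
          Finset.mem_singleton, this]
        grind
      · simp only [Finset.mem_filter, Finset.mem_univ, true_and, Finset.union_empty, this]
        grind
    rw [this, Finset.card_union_of_disjoint]
    · split <;> simp
    · split <;> simp
  funext v
  refine eq_of_forall_gt_iff fun k => ?_
  by_cases hk : k ≤ n
  · have h1 := step t v k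
    have h2 := step t' v k
    rw [h _ v.2 k hk, h _ v.2.le k hk] at h1
    rw [h1] at h2
    by_cases a : t.row v < k <;> by_cases b : t'.row v < k <;> simp [a, b] at h2 ⊢
  · have := t.row_lt v
    have := t'.row_lt v
    omega

end StandardTableau

end Nat.Partition

/-! ## Sums of permutations with prescribed fibres -/

namespace SymGroupAlgebra

variable {n : ℕ} (R : Type*) [CommRing R]

/-- The permutations that carry the labelling `g` to the labelling `f`. -/
def carrying (f g : Fin n → ℕ) : Finset (Equiv.Perm (Fin n)) :=
  Finset.univ.filter fun π => ∀ v, f (π v) = g v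

theorem mem_carrying {f g : Fin n → ℕ} {π : Equiv.Perm (Fin n)} :
    π ∈ carrying f g ↔ ∀ v, f (π v) = g v := by
  simp [carrying]

/-- The sum of the permutations that carry the labelling `g` to the labelling `f`. -/
noncomputable def carryingSum (f g : Fin n → ℕ) : MonoidAlgebra R (Equiv.Perm (Fin n)) :=
  ∑ π ∈ carrying f g, MonoidAlgebra.of R _ π

/-- A two-sided translate of a Young subgroup is the set of permutations that match two labellings
by blocks. -/
theorem of_mul_groupSum_mul_of (l : n.Partition) (α β : Equiv.Perm (Fin n)) :
    MonoidAlgebra.of R _ α * groupSum R l.youngSubgroup * MonoidAlgebra.of R _ β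
      = carryingSum R (fun v => l.blockIdx (α⁻¹ v)) (fun v => l.blockIdx (β v)) := by
  classical
  rw [groupSum, Finset.mul_sum, Finset.sum_mul, carryingSum]
  refine Finset.sum_equiv ((Equiv.mulLeft α).trans (Equiv.mulRight β)) (fun σ => ?_)
    (fun σ _ => ?_)
  · simp only [Finset.mem_filter, Finset.mem_univ, true_and, mem_carrying,
      Nat.Partition.mem_youngSubgroup_iff, Equiv.trans_apply, Equiv.coe_mulLeft,
      Equiv.coe_mulRight, Equiv.Perm.mul_apply, Equiv.Perm.coe_inv, Equiv.symm_apply_apply]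
    exact ⟨fun h v => h (β v), fun h v => by simpa using h (β⁻¹ v)⟩
  · simp [map_mul]

theorem exists_perm_of_card_eq {f g : Fin n → ℕ}
    (h : ∀ k, (Finset.univ.filter fun v => f v = k).card
      = (Finset.univ.filter fun v => g v = k).card) :
    ∃ τ : Equiv.Perm (Fin n), ∀ v, f (τ v) = g v := by
  have e : ∀ k, Nonempty ({v // g v = k} ≃ {v // f v = k}) := fun k => by
    refine ⟨Fintype.equivOfCardEq ?_⟩
    rw [Fintype.card_subtype, Fintype.card_subtype, h]
  exact ⟨Equiv.ofFiberEquiv fun k => (e k).some, fun v => Equiv.ofFiberEquiv_map _ v⟩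

/-- Only the fibres of `f` matter, not their names. With the names `f'`, the fibres have the sizes
of the blocks of `l`, and the sum is a translate of the generator for `l`. -/
theorem carryingSum_mem_youngIdeal {Δ : Finset n.Partition} {l : n.Partition} (hl : l ∈ Δ)
    {f f' : Fin n → ℕ} (hff : ∀ u v, f u = f v ↔ f' u = f' v)
    (hf' : ∀ k, (Finset.univ.filter fun v => f' v = k).card = l.rowLen k)
    (σ : Equiv.Perm (Fin n)) :
    carryingSum R f (fun v => f (σ v)) ∈ youngIdeal R Δ := by
  obtain ⟨τ, hτ⟩ := exists_perm_of_card_eq (f := f') (g := l.blockIdx)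
    fun k => (hf' k).trans (l.card_blockIdx_eq k).symm
  have h1 : carryingSum R f (fun v => f (σ v))
      = MonoidAlgebra.of R _ τ * groupSum R l.youngSubgroup * MonoidAlgebra.of R _ (τ⁻¹ * σ) := by
    rw [of_mul_groupSum_mul_of, carryingSum, carryingSum]
    congr 1
    ext π
    simp only [mem_carrying, hff, ← hτ, Equiv.Perm.mul_apply, Equiv.Perm.coe_inv,
      Equiv.apply_symm_apply]
  rw [h1, youngIdeal, Submodule.restrictScalars_mem, TwoSidedIdeal.mem_asIdeal]
  exact TwoSidedIdeal.mul_mem_right _ _ _ (TwoSidedIdeal.mul_mem_left _ _ _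
    (TwoSidedIdeal.subset_span ⟨l, hl, rfl⟩))

/-! ## Signed sums of coefficients -/

/-- The signed sum of the coefficients at the permutations that carry `g` to `f`. -/
noncomputable def signedForm (f g : Fin n → ℕ) :
    MonoidAlgebra R (Equiv.Perm (Fin n)) →ₗ[R] R :=
  ∑ π ∈ carrying f g, ((Equiv.Perm.sign π : ℤ) : R) •
    (Finsupp.lapply π ∘ₗ (MonoidAlgebra.coeffLinearEquiv R).toLinearMap)

theorem signedForm_of (f g : Fin n → ℕ) (σ : Equiv.Perm (Fin n)) :
    signedForm R f g (MonoidAlgebra.of R _ σ)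
      = if σ ∈ carrying f g then ((Equiv.Perm.sign σ : ℤ) : R) else 0 := by
  classical
  have : ∀ π : Equiv.Perm (Fin n), (MonoidAlgebra.coeffLinearEquiv R
      (MonoidAlgebra.of R _ σ)) π = if σ = π then (1 : R) else 0 := fun π => by
    change (MonoidAlgebra.single σ (1 : R)).coeff π = _
    rw [MonoidAlgebra.coeff_single, Finsupp.single_apply]
  simp [signedForm, this, -MonoidAlgebra.of_apply, -MonoidAlgebra.coeffLinearEquiv_apply]

theorem signedForm_carryingSum (f g a b : Fin n → ℕ) :
    signedForm R f g (carryingSum R a b)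
      = ∑ π ∈ carrying a b ∩ carrying f g, ((Equiv.Perm.sign π : ℤ) : R) := by
  rw [carryingSum, map_sum, Finset.sum_congr rfl fun π _ => signedForm_of R f g π,
    ← Finset.sum_filter, Finset.filter_mem_eq_inter]

/-- Composition with the transposition of `u` and `v` is a sign-reversing involution on the
permutations that contribute. -/
theorem signedForm_carryingSum_eq_zero_right {f g a b : Fin n → ℕ} {u v : Fin n} (huv : u ≠ v)
    (hb : b u = b v) (hg : g u = g v) : signedForm R f g (carryingSum R a b) = 0 := by
  rw [signedForm_carryingSum]
  refine Finset.sum_involution (fun π _ => π * Equiv.swap u v) ?_ ?_ ?_ ?_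
  · intro π _
    simp [Equiv.Perm.sign_swap huv]
  · intro π _ _ h
    exact huv (by simpa using h)
  · intro π hπ
    simp only [Finset.mem_inter, mem_carrying, Equiv.Perm.mul_apply] at hπ ⊢
    refine ⟨fun w => ?_, fun w => ?_⟩
    · rw [hπ.1, Equiv.swap_apply_def]
      split_ifs <;> simp_all
    · rw [hπ.2, Equiv.swap_apply_def]
      split_ifs <;> simp_all
  · intro π _
    simp [mul_assoc]

theorem signedForm_carryingSum_eq_zero_left {f g a b : Fin n → ℕ} {u v : Fin n} (huv : u ≠ v)
    (ha : a u = a v) (hf : f u = f v) : signedForm R f g (carryingSum R a b) = 0 := by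
  rw [signedForm_carryingSum]
  refine Finset.sum_involution (fun π _ => Equiv.swap u v * π) ?_ ?_ ?_ ?_
  · intro π _
    simp [Equiv.Perm.sign_swap huv]
  · intro π _ _ h
    exact huv (by simpa using h)
  · intro π hπ
    simp only [Finset.mem_inter, mem_carrying, Equiv.Perm.mul_apply] at hπ ⊢
    refine ⟨fun w => ?_, fun w => ?_⟩
    · rw [← hπ.1, Equiv.swap_apply_def]
      split_ifs <;> simp_all
    · rw [← hπ.2, Equiv.swap_apply_def]
      split_ifs <;> simp_all
  · intro π _
    simp [← mul_assoc]

variable {l l' : n.Partition}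

/-- Without cancellation, entries sharing a row of `s` lie in different columns of `s'`, so
`card_le_count` applies to the rows of `s` as labels; likewise for `t` and `t'`. -/
theorem count_le_of_signedForm_ne_zero {s t : l.StandardTableau} {s' t' : l'.StandardTableau}
    (h : signedForm R s'.col t'.col (carryingSum R s.row t.row) ≠ 0) (m k : ℕ) :
    s.count m k ≤ s'.count m k ∧ t.count m k ≤ t'.count m k :=
  ⟨s'.card_le_count s.row (fun _ _ huv hr hc =>
      h (signedForm_carryingSum_eq_zero_left R huv hr hc)) m k,
    t'.card_le_count t.row (fun _ _ huv hr hc =>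
      h (signedForm_carryingSum_eq_zero_right R huv hr hc)) m k⟩

/-- Just one permutation carries both the rows and the columns of `t` to those of `s`, so the value
is its sign. -/
theorem isUnit_signedForm_self (s t : l.StandardTableau) :
    IsUnit (signedForm R s.col t.col (carryingSum R s.row t.row)) := by
  have : carrying s.row t.row ∩ carrying s.col t.col = {t.1.symm.trans s.1} := by
    ext π
    simp only [Finset.mem_inter, mem_carrying, Finset.mem_singleton]
    constructor
    · rintro ⟨h1, h2⟩
      refine Equiv.ext fun v => s.eq_of_row_col ?_ ?_
      · rw [h1]
        simp [Nat.Partition.StandardTableau.row]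
      · rw [h2]
        simp [Nat.Partition.StandardTableau.col]
    · rintro rfl
      simp [Nat.Partition.StandardTableau.row, Nat.Partition.StandardTableau.col]
  rw [signedForm_carryingSum, this, Finset.sum_singleton]
  exact (Units.isUnit _).map (Int.castRingHom R)

/-- A nonzero value at a translate of the generator for `m` would give `m ≤ l` by `card_le_count`,
and hence `l ∈ Δ`. -/
theorem signedForm_eq_zero_of_mem_youngIdeal {Δ : Finset n.Partition}
    (hΔ : IsUpperSet (Δ : Set n.Partition)) (hl : l ∉ Δ) (s t : l.StandardTableau)
    {x : MonoidAlgebra R (Equiv.Perm (Fin n))} (hx : x ∈ youngIdeal R Δ) :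
    signedForm R s.col t.col x = 0 := by
  have key : ∀ m ∈ Δ, ∀ α β : Equiv.Perm (Fin n), signedForm R s.col t.col
      (MonoidAlgebra.of R _ α * groupSum R m.youngSubgroup * MonoidAlgebra.of R _ β) = 0 := by
    intro m hm α β
    rw [of_mul_groupSum_mul_of]
    by_contra h
    refine hl (hΔ (a := m) (fun k => ?_) hm)
    have := t.card_le_count (fun v => m.blockIdx (β v)) (fun _ _ huv hr hc =>
      h (signedForm_carryingSum_eq_zero_right R huv hr hc)) n k
    rw [t.count_self] at this
    refine le_trans (le_of_eq ?_) this
    rw [← m.card_blockIdx_lt]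
    refine Finset.card_equiv β.symm fun v => ?_
    simp
  rw [youngIdeal, Submodule.restrictScalars_mem, TwoSidedIdeal.mem_asIdeal,
    TwoSidedIdeal.mem_span_iff_mem_addSubgroup_closure] at hx
  induction hx using AddSubgroup.closure_induction with
  | mem x hx =>
    obtain ⟨-, ⟨a, -, -, ⟨m, hm, rfl⟩, rfl⟩, b, -, rfl⟩ := hx
    change signedForm R s.col t.col (a * groupSum R m.youngSubgroup * b) = 0
    induction a using MonoidAlgebra.induction_on with
    | of α =>
      induction b using MonoidAlgebra.induction_on with
      | of β => exact key m hm α β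
      | add b b' hb hb' => rw [mul_add, map_add, hb, hb', add_zero]
      | smul r b hb => rw [mul_smul_comm, map_smul, hb, smul_zero]
    | add a a' ha ha' => rw [add_mul, add_mul, map_add, ha, ha', add_zero]
    | smul r a ha => rw [smul_mul_assoc, smul_mul_assoc, map_smul, ha, smul_zero]
  | zero => exact map_zero _
  | add x y _ _ hx hy => rw [map_add, hx, hy, add_zero]
  | neg x _ hx => rw [map_neg, hx, neg_zero]

end SymGroupAlgebra

/-! ## Unitriangular systems -/

/-- Back substitution: the column of `q` is a unit times the basis vector of `q`, up to basis
vectors with larger `r`, which are already in the range. -/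
theorem Matrix.mulVecLin_surjective_of_triangular {ι R : Type*} [Fintype ι] [CommRing R]
    (M : Matrix ι ι R) (r : ι → ℕ) (h : ∀ p q, M p q ≠ 0 → p = q ∨ r q < r p)
    (hd : ∀ p, IsUnit (M p p)) : Function.Surjective M.mulVecLin := by
  classical
  rw [← LinearMap.range_eq_top, ← top_le_iff, ← (Pi.basisFun R ι).span_eq, Submodule.span_le]
  rintro _ ⟨q, rfl⟩
  induction hq : (Finset.univ.sup r) - r q using Nat.strong_induction_on generalizing q with
  | _ N ih =>
    subst hq
    rw [SetLike.mem_coe, Pi.basisFun_apply]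
    have e : M.mulVecLin (Pi.single q 1) = M q q • Pi.single q 1
        + ∑ p ∈ Finset.univ.erase q, M p q • Pi.single p 1 := by
      rw [Finset.add_sum_erase _ (fun p => M p q • (Pi.single p 1 : ι → R)) (Finset.mem_univ q)]
      funext p
      simp [Matrix.mulVec_single, Finset.sum_apply, Pi.single_apply]
    have h2 : M q q • (Pi.single q 1 : ι → R) ∈ LinearMap.range M.mulVecLin := by
      rw [← sub_eq_iff_eq_add] at e
      rw [← e]
      refine Submodule.sub_mem _ (LinearMap.mem_range_self _ _) (Submodule.sum_mem _ fun p hp => ?_)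
      by_cases hM : M p q = 0
      · rw [hM, zero_smul]
        exact Submodule.zero_mem _
      · rcases h p q hM with rfl | hlt
        · simp at hp
        · refine Submodule.smul_mem _ _ ?_
          have hb : r p ≤ Finset.univ.sup r := Finset.le_sup (Finset.mem_univ p)
          simpa using ih (Finset.univ.sup r - r p) (by omega) p rfl
    obtain ⟨u, hu⟩ := hd q
    have := Submodule.smul_mem _ (↑u⁻¹ : R) h2
    rwa [smul_smul, ← hu, Units.inv_mul, one_smul] at this

theorem Matrix.mulVecLin_injective_of_triangular {ι R : Type*} [Fintype ι] [CommRing R]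
    (M : Matrix ι ι R) (r : ι → ℕ) (h : ∀ p q, M p q ≠ 0 → p = q ∨ r q < r p)
    (hd : ∀ p, IsUnit (M p p)) : Function.Injective M.mulVecLin :=
  OrzechProperty.injective_of_surjective_endomorphism _
    (M.mulVecLin_surjective_of_triangular r h hd)

/-! ## The basis of row sums indexed by pairs of standard tableaux -/

namespace SymGroupAlgebra

variable {n : ℕ} (R : Type*) [CommRing R]

/-- Pairs of standard tableaux of the same shape. -/
abbrev TableauPair (n : ℕ) : Type :=
  Σ l : n.Partition, l.StandardTableau × l.StandardTableau

noncomputable instance (l : n.Partition) : Fintype l.StandardTableau := Fintype.ofFinite _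

/-- The sum of the permutations that carry the rows of one tableau to those of another. -/
noncomputable def rowSum (p : TableauPair n) : MonoidAlgebra R (Equiv.Perm (Fin n)) :=
  carryingSum R p.2.1.row p.2.2.row

/-- The signed sum of the coefficients at the permutations that carry the columns of one tableau
to those of another. -/
noncomputable def colForm (p : TableauPair n) : MonoidAlgebra R (Equiv.Perm (Fin n)) →ₗ[R] R :=
  signedForm R p.2.1.col p.2.2.col

/-- A number that measures how far up the entries of the two tableaux are. -/
def height (p : TableauPair n) : ℕ :=
  ∑ m ∈ Finset.range (n + 1), ∑ k ∈ Finset.range (n + 1), (p.2.1.count m k + p.2.2.count m k)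

/-- All counts of `q` are at most those of `p`. If the heights agree, then so do all counts, hence
the rows of all entries, the shapes and the tableaux. -/
theorem colForm_rowSum_ne_zero {p q : TableauPair n} (h : colForm R p (rowSum R q) ≠ 0) :
    p = q ∨ height q < height p := by
  have hc := count_le_of_signedForm_ne_zero R h
  have hle : ∀ m ∈ Finset.range (n + 1), ∑ k ∈ Finset.range (n + 1),
      (q.2.1.count m k + q.2.2.count m k)
      ≤ ∑ k ∈ Finset.range (n + 1), (p.2.1.count m k + p.2.2.count m k) := fun m _ =>
    Finset.sum_le_sum fun k _ => add_le_add (hc m k).1 (hc m k).2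
  rcases (Finset.sum_le_sum hle).eq_or_lt with he | hlt
  swap
  · exact Or.inr hlt
  left
  have he' : ∀ m ≤ n, ∀ k ≤ n, q.2.1.count m k = p.2.1.count m k ∧
      q.2.2.count m k = p.2.2.count m k := by
    intro m hm k hk
    have h1 := (Finset.sum_eq_sum_iff_of_le hle).1 he m (Finset.mem_range.2 (by omega))
    have h2 := (Finset.sum_eq_sum_iff_of_le
      fun k _ => add_le_add (hc m k).1 (hc m k).2).1 h1 k (Finset.mem_range.2 (by omega))
    have := hc m k
    omega
  have hs := Nat.Partition.StandardTableau.row_eq_of_count_eq fun m hm k hk => (he' m hm k hk).1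
  have ht := Nat.Partition.StandardTableau.row_eq_of_count_eq fun m hm k hk => (he' m hm k hk).2
  obtain ⟨l, s, t⟩ := p
  obtain ⟨l', s', t'⟩ := q
  obtain rfl : l = l' := Nat.Partition.eq_of_rowLen_eq fun i => by
    rw [← s.card_row_eq, ← s'.card_row_eq]
    simp only at hs
    rw [hs]
  obtain rfl : s' = s := Nat.Partition.StandardTableau.row_injective hs
  obtain rfl : t' = t := Nat.Partition.StandardTableau.row_injective ht
  rfl

theorem isUnit_colForm_rowSum (p : TableauPair n) : IsUnit (colForm R p (rowSum R p)) :=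
  isUnit_signedForm_self R _ _

/-- The matrix of the values of the forms at the row sums. -/
noncomputable def pairingMatrix : Matrix (TableauPair n) (TableauPair n) R :=
  fun p q => colForm R p (rowSum R q)

theorem pi_colForm_comp_linearCombination :
    LinearMap.pi (colForm R) ∘ₗ Fintype.linearCombination R (rowSum R)
      = (pairingMatrix (n := n) R).mulVecLin := by
  refine LinearMap.ext fun c => funext fun p => ?_
  simp [Fintype.linearCombination_apply, pairingMatrix, Matrix.mulVec, dotProduct, mul_comm]

theorem linearCombination_rowSum_injective :
    Function.Injective (Fintype.linearCombination R (rowSum (n := n) R)) := by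
  refine Function.Injective.of_comp (f := LinearMap.pi (colForm R)) ?_
  rw [← LinearMap.coe_comp, pi_colForm_comp_linearCombination]
  exact Matrix.mulVecLin_injective_of_triangular _ height
    (fun p q h => colForm_rowSum_ne_zero R h) (isUnit_colForm_rowSum R)

/-! ### From independence to a basis by counting -/

theorem linearIndependent_rowSum : LinearIndependent R (rowSum (n := n) R) :=
  linearIndependent_iff_injective_fintypeLinearCombination.2 (linearCombination_rowSum_injective R)

theorem card_tableauPair : Fintype.card (TableauPair n) = ∑ l : n.Partition, l.numStandard ^ 2 := by
  rw [Fintype.card_sigma]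
  refine Finset.sum_congr rfl fun l _ => ?_
  rw [Fintype.card_prod, sq, Nat.Partition.numStandard, Nat.card_eq_fintype_card]

theorem card_perm_eq_sum_card_shape : Fintype.card (Equiv.Perm (Fin n))
    = ∑ l : n.Partition, Nat.card {σ : Equiv.Perm (Fin n) // RobinsonSchensted.shape σ = l} := by
  rw [← Fintype.card_congr (Equiv.sigmaFiberEquiv
    (RobinsonSchensted.shape : Equiv.Perm (Fin n) → n.Partition)), Fintype.card_sigma]
  simp [Nat.card_eq_fintype_card]

theorem card_tableauPair_le : Fintype.card (TableauPair n) ≤ Fintype.card (Equiv.Perm (Fin n)) := by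
  have : Module.Finite ℤ (MonoidAlgebra ℤ (Equiv.Perm (Fin n))) :=
    Module.Finite.of_basis (MonoidAlgebra.basis _ ℤ)
  rw [← Module.finrank_eq_card_basis (MonoidAlgebra.basis (Equiv.Perm (Fin n)) ℤ)]
  exact (linearIndependent_rowSum ℤ).fintype_card_le_finrank

/-- Two opposite bounds meet: independent row sums over ℤ on one side, injectivity of the
Robinson–Schensted map on the other. -/
theorem card_tableauPair_eq : Fintype.card (TableauPair n) = Fintype.card (Equiv.Perm (Fin n)) := by
  refine le_antisymm card_tableauPair_le ?_
  rw [card_perm_eq_sum_card_shape, card_tableauPair]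
  exact Finset.sum_le_sum fun l _ => RobinsonSchensted.card_shape_le l

/-- The number of permutations of a given shape. -/
theorem card_shape_eq (l : n.Partition) :
    Nat.card {σ : Equiv.Perm (Fin n) // RobinsonSchensted.shape σ = l} = l.numStandard ^ 2 := by
  have h := card_tableauPair_eq (n := n)
  rw [card_perm_eq_sum_card_shape, card_tableauPair] at h
  exact (Finset.sum_eq_sum_iff_of_le fun l _ => RobinsonSchensted.card_shape_le l).1 h.symm l
    (Finset.mem_univ l)

theorem pi_colForm_injective :
    Function.Injective (LinearMap.pi (colForm (n := n) R)) := by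
  let e : MonoidAlgebra R (Equiv.Perm (Fin n)) ≃ₗ[R] (TableauPair n → R) :=
    ((MonoidAlgebra.basis _ R).reindex (Fintype.equivOfCardEq card_tableauPair_eq.symm)).equivFun
  refine OrzechProperty.injective_of_surjective_of_injective e.toLinearMap _ e.injective ?_
  refine Function.Surjective.of_comp (g := Fintype.linearCombination R (rowSum R)) ?_
  rw [← LinearMap.coe_comp, pi_colForm_comp_linearCombination]
  exact Matrix.mulVecLin_surjective_of_triangular _ height
    (fun p q h => colForm_rowSum_ne_zero R h) (isUnit_colForm_rowSum R)

/-- The triangular system is solved for the values of the forms at `x`; the forms separate elements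
by `pi_colForm_injective`. -/
theorem span_rowSum : ⊤ ≤ Submodule.span R (Set.range (rowSum (n := n) R)) := by
  intro x _
  obtain ⟨c, hc⟩ := Matrix.mulVecLin_surjective_of_triangular (pairingMatrix R) height
    (fun p q h => colForm_rowSum_ne_zero R h) (isUnit_colForm_rowSum R)
    (LinearMap.pi (colForm R) x)
  rw [← pi_colForm_comp_linearCombination] at hc
  rw [← pi_colForm_injective R hc, ← Fintype.range_linearCombination]
  exact LinearMap.mem_range_self _ _

/-- The row sums form a basis of the group algebra. -/
noncomputable def rowBasis :
    Module.Basis (TableauPair n) R (MonoidAlgebra R (Equiv.Perm (Fin n))) :=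
  Module.Basis.mk (linearIndependent_rowSum R) (span_rowSum R)

theorem rowBasis_apply (p : TableauPair n) : rowBasis R p = rowSum R p :=
  Module.Basis.mk_apply _ _ _

theorem rowSum_mem_youngIdeal {Δ : Finset n.Partition} {p : TableauPair n} (hp : p.1 ∈ Δ) :
    rowSum R p ∈ youngIdeal R Δ := by
  have := carryingSum_mem_youngIdeal R hp (f := p.2.1.row) (fun _ _ => Iff.rfl) p.2.1.card_row_eq
    (p.2.2.1.symm.trans p.2.1.1)
  have e : (fun v => p.2.1.row (p.2.2.1.symm.trans p.2.1.1 v)) = p.2.2.row := by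
    funext v
    simp [Nat.Partition.StandardTableau.row]
  rwa [e] at this

/-! ### The ideal in terms of the row sums -/

section

variable {Δ : Finset n.Partition}

/-- Apply the form of `p` to the expansion of `x`. Terms with shape in `Δ` vanish because their row
sums lie in the ideal, others by triangularity or by induction on the height; a unit times the
coefficient at `p` remains. -/
theorem repr_eq_zero_of_mem_youngIdeal (hΔ : IsUpperSet (Δ : Set n.Partition))
    {x : MonoidAlgebra R (Equiv.Perm (Fin n))} (hx : x ∈ youngIdeal R Δ) {p : TableauPair n}
    (hp : p.1 ∉ Δ) : (rowBasis R).repr x p = 0 := by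
  induction hN : height p using Nat.strong_induction_on generalizing p with
  | _ N ih =>
    subst hN
    have h0 : colForm R p x = 0 := signedForm_eq_zero_of_mem_youngIdeal R hΔ hp _ _ hx
    rw [← (rowBasis R).sum_repr x, map_sum, Finset.sum_eq_single p] at h0
    · rw [map_smul, rowBasis_apply, smul_eq_mul] at h0
      exact ((isUnit_colForm_rowSum R p).mul_left_eq_zero).1 h0
    · intro q _ hqp
      rw [map_smul, rowBasis_apply, smul_eq_mul]
      by_cases hq : q.1 ∈ Δ
      · have : colForm R p (rowSum R q) = 0 :=
          signedForm_eq_zero_of_mem_youngIdeal R hΔ hp _ _ (rowSum_mem_youngIdeal R hq)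
        rw [this, mul_zero]
      · by_cases hz : colForm R p (rowSum R q) = 0
        · rw [hz, mul_zero]
        · rcases colForm_rowSum_ne_zero R hz with h | h
          · exact absurd h.symm hqp
          · rw [ih _ h hq rfl, zero_mul]
    · simp

theorem youngIdeal_eq_span (hΔ : IsUpperSet (Δ : Set n.Partition)) : youngIdeal R Δ
    = Submodule.span R (Set.range fun p : {p : TableauPair n // p.1 ∈ Δ} => rowSum R p.1) := by
  refine le_antisymm (fun x hx => ?_) ?_
  · rw [← (rowBasis R).sum_repr x]
    refine Submodule.sum_mem _ fun p _ => ?_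
    by_cases hp : p.1 ∈ Δ
    · rw [rowBasis_apply]
      exact Submodule.smul_mem _ _ (Submodule.subset_span ⟨⟨p, hp⟩, rfl⟩)
    · rw [repr_eq_zero_of_mem_youngIdeal R hΔ hx hp, zero_smul]
      exact Submodule.zero_mem _
  · rw [Submodule.span_le]
    rintro _ ⟨p, rfl⟩
    exact rowSum_mem_youngIdeal R p.2

/-- The row sums of the shapes in `Δ` form a basis of the ideal. -/
noncomputable def youngIdealBasis (hΔ : IsUpperSet (Δ : Set n.Partition)) :
    Module.Basis {p : TableauPair n // p.1 ∈ Δ} R (youngIdeal R Δ) :=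
  (Module.Basis.span ((linearIndependent_rowSum R).comp (Subtype.val :
    {p : TableauPair n // p.1 ∈ Δ} → TableauPair n) Subtype.val_injective)).map
    (LinearEquiv.ofEq _ _ (youngIdeal_eq_span R hΔ).symm)

theorem youngIdealBasis_apply (hΔ : IsUpperSet (Δ : Set n.Partition))
    (p : {p : TableauPair n // p.1 ∈ Δ}) :
    (youngIdealBasis R hΔ p : MonoidAlgebra R (Equiv.Perm (Fin n))) = rowSum R p.1 := by
  rw [youngIdealBasis, Module.Basis.map_apply, LinearEquiv.coe_ofEq_apply, Module.Basis.span_apply]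
  rfl

end

theorem card_tableauPair_mem (Δ : Finset n.Partition) :
    Fintype.card {p : TableauPair n // p.1 ∈ Δ} = ∑ l ∈ Δ, l.numStandard ^ 2 := by
  rw [Fintype.card_subtype, Finset.card_eq_sum_card_fiberwise (f := Sigma.fst) (t := Δ)
    (fun p hp => by simpa using hp)]
  refine Finset.sum_congr rfl fun l hl => ?_
  rw [Finset.filter_filter, ← Fintype.card_subtype, sq, Nat.Partition.numStandard,
    Nat.card_eq_fintype_card, ← Fintype.card_prod]
  refine Fintype.card_congr ((Equiv.subtypeEquivRight fun p => ?_).trans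
    (Equiv.sigmaSubtype (β := fun l : n.Partition => l.StandardTableau × l.StandardTableau) l))
  constructor
  · exact fun h => h.2
  · rintro rfl
    exact ⟨hl, rfl⟩

end SymGroupAlgebra

/-! ## Permutations of the shapes in `Γ` span a complement -/

namespace SymGroupAlgebra

variable {n : ℕ} (R : Type*) [CommRing R]

/-- The fibres of a labelling, ordered by size, form a partition of `n`. -/
theorem exists_partition_of_fibers (f : Fin n → ℕ) :
    ∃ (l : n.Partition) (f' : Fin n → ℕ), (∀ u v, f u = f v ↔ f' u = f' v) ∧
      (∀ k, (Finset.univ.filter fun v => f' v = k).card = l.rowLen k) ∧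
      ∀ k, l.conj.partialSum k
        = ∑ i ∈ Finset.univ.image f, min (Finset.univ.filter fun v => f v = i).card k := by
  classical
  set c : ℕ → ℕ := fun i => (Finset.univ.filter fun v => f v = i).card with hc
  let r : ℕ → ℕ → Prop := fun i j => c i ≥ c j
  have : Std.Total r := ⟨fun a b => le_total (c b) (c a)⟩
  have : IsTrans ℕ r := ⟨fun a b d h1 h2 => le_trans h2 h1⟩
  set L := (Finset.univ.image f).toList.insertionSort r with hL
  have hperm : L.Perm (Finset.univ.image f).toList := List.perm_insertionSort r _
  have hnd : L.Nodup := hperm.nodup_iff.2 (Finset.nodup_toList _)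
  have hmem : ∀ v, f v ∈ L := fun v => hperm.mem_iff.2 (by simp)
  have hsort : (L.map c).Pairwise (· ≥ ·) :=
    List.pairwise_map.2 (List.pairwise_insertionSort r _)
  have hsumL : ∀ g : ℕ → ℕ, (L.map g).sum = ∑ i ∈ Finset.univ.image f, g i := fun g => by
    rw [(hperm.map g).sum_eq, Finset.sum_map_toList]
  have hsum : ((L.map c : List ℕ) : Multiset ℕ).sum = n := by
    rw [Multiset.sum_coe, hsumL, ← Finset.card_eq_sum_card_image]
    simp
  have hpos : (L.map c).filter (· ≠ 0) = L.map c := by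
    rw [List.filter_eq_self]
    intro a ha
    obtain ⟨i, hi, rfl⟩ := List.mem_map.1 ha
    have hi' := hperm.mem_iff.1 hi
    simp only [Finset.mem_toList, Finset.mem_image, Finset.mem_univ, true_and] at hi'
    obtain ⟨v, rfl⟩ := hi'
    have : 0 < c (f v) := Finset.card_pos.2 ⟨v, by simp⟩
    simpa using this.ne'
  have hrows : (Nat.Partition.ofSums n (L.map c : List ℕ) hsum).rows = L.map c := by
    rw [Nat.Partition.rows_ofSums _ hsort, hpos]
  -- The new label is the position of the old one in the list of labels sorted by decreasing fibre
  -- size.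
  refine ⟨Nat.Partition.ofSums n (L.map c : List ℕ) hsum, fun v => L.idxOf (f v), ?_, ?_, ?_⟩
  · intro u v
    exact (List.idxOf_inj (hmem u)).symm
  · intro k
    rw [Nat.Partition.rowLen, hrows]
    by_cases hk : k < L.length
    · have : ∀ v, L.idxOf (f v) = k ↔ f v = L[k] := fun v => by
        constructor
        · rintro rfl
          simp
        · intro h
          rw [h, hnd.idxOf_getElem]
      simp [this, List.getD, hk, hc]
    · rw [List.getD_eq_default _ _ (by simpa using hk), Finset.card_eq_zero,
        Finset.filter_eq_empty_iff]
      rintro v - rfl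
      exact hk (List.idxOf_lt_length_iff.2 (hmem v))
  · intro k
    rw [Nat.Partition.partialSum_conj, ← Nat.Partition.coe_rows, hrows, Multiset.map_coe,
      Multiset.sum_coe, List.map_map, hsumL]
    rfl

/-- A permutation that is decreasing on the fibres of a labelling is the lexicographically largest
one in its class. -/
theorem toLex_lt_of_mem_carrying {f : Fin n → ℕ} {σ π : Equiv.Perm (Fin n)}
    (hσ : ∀ i j, i < j → f (σ i) = f (σ j) → σ j < σ i)
    (hπ : π ∈ carrying f (fun v => f (σ v))) (hne : π ≠ σ) : toLex ⇑π < toLex ⇑σ := by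
  rw [mem_carrying] at hπ
  have hex : ∃ i, π i ≠ σ i := by
    by_contra h
    push Not at h
    exact hne (Equiv.ext h)
  obtain ⟨i, hi, hmin⟩ := WellFounded.has_min (wellFounded_lt (α := Fin n)) {i | π i ≠ σ i} hex
  have hlt : ∀ j < i, π j = σ j := fun j hj => by
    by_contra h
    exact hmin j h hj
  refine ⟨i, hlt, ?_⟩
  -- At the first difference `i`, the value `π i` is `σ j` for some `j` in the same class. Agreement
  -- before `i` forces `j > i`, so the value is smaller than `σ i`.
  obtain ⟨j, hj⟩ := σ.surjective (π i)
  change π i < σ i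
  rw [← hj]
  rcases lt_trichotomy i j with h | h | h
  · exact hσ i j h (by rw [hj, hπ])
  · subst h
    exact absurd hj.symm hi
  · rw [← hlt j h] at hj
    exact absurd (π.injective hj) h.ne

theorem weight_range (k : ℕ) (c : ℕ → ℕ) :
    RobinsonSchensted.weight k c (Finset.range n)
      = ∑ i ∈ Finset.univ.image (fun v : Fin n => c v),
        min (Finset.univ.filter fun v : Fin n => c v = i).card k := by
  have hr : Finset.range n = (Finset.univ : Finset (Fin n)).map Fin.valEmbedding := by
    rw [Fin.map_valEmbedding_univ]
    ext
    simp
  rw [RobinsonSchensted.weight, hr]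
  have : ((Finset.univ : Finset (Fin n)).map Fin.valEmbedding).image c
      = Finset.univ.image (fun v : Fin n => c v) := by
    rw [Finset.map_eq_image, Finset.image_image]
    rfl
  rw [this]
  refine Finset.sum_congr rfl fun i _ => ?_
  rw [Finset.filter_map, Finset.card_map]
  rfl

/-! ### Straightening and comparison of ranks -/

section

variable {Γ Δ : Finset n.Partition} {ν : n.Partition}

/-- The colouring depends on `k` and controls only the `k`-th partial sum of the conjugate of its
class sizes. This suffices because `Γ` consists of all `l ≥ ν`: one partial sum below that of `ν`
excludes the conjugate from `Γ`, so the class sizes form a partition in `Δ`. -/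
theorem exists_carryingSum_mem_youngIdeal (hΓ : ∀ l, l ∈ Γ ↔ ν ≤ l)
    (hΔ : Δ = Finset.univ \ Γ.image Nat.Partition.conj) {σ : Equiv.Perm (Fin n)}
    (hσ : RobinsonSchensted.shape σ ∉ Γ) :
    ∃ f : Fin n → ℕ, (∀ i j, i < j → f (σ i) = f (σ j) → σ j < σ i) ∧
      carryingSum R f (fun v => f (σ v)) ∈ youngIdeal R Δ := by
  rw [hΓ] at hσ
  obtain ⟨k, hk⟩ : ∃ k, (RobinsonSchensted.shape σ).partialSum k < ν.partialSum k := by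
    by_contra h
    push Not at h
    exact hσ h
  obtain ⟨c, hc, hw⟩ := RobinsonSchensted.hasDecreasingColoring_word σ k
  obtain ⟨l, f', hff, hf', hl⟩ := exists_partition_of_fibers fun v : Fin n => c v
  have hS : (RobinsonSchensted.word σ).toFinset = Finset.range n := by
    rw [List.toFinset_eq_of_perm _ _ (RobinsonSchensted.word_perm σ), List.toFinset_range]
  rw [hS, weight_range, ← hl] at hw
  refine ⟨fun v => c v, fun i j hij h => ?_, carryingSum_mem_youngIdeal R ?_ hff hf' σ⟩
  · have := List.pairwise_ofFn.1 hc hij h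
    exact this
  · rw [hΔ]
    simp only [Finset.mem_sdiff, Finset.mem_univ, true_and, Finset.mem_image, not_exists, not_and]
    rintro m hm rfl
    rw [Nat.Partition.conj_conj] at hw
    have := (hΓ m).1 hm k
    omega

/-- Modulo the ideal, a permutation with shape outside `Γ` is minus a sum of lexicographically
smaller ones, so the rewriting terminates. -/
theorem codisjoint_spanG_youngIdeal (hΓ : ∀ l, l ∈ Γ ↔ ν ≤ l)
    (hΔ : Δ = Finset.univ \ Γ.image Nat.Partition.conj) :
    spanG R Γ ⊔ youngIdeal R Δ = ⊤ := by
  have key : ∀ σ : Equiv.Perm (Fin n), MonoidAlgebra.of R _ σ ∈ spanG R Γ ⊔ youngIdeal R Δ := by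
    intro σ
    induction h : toLex (⇑σ) using WellFoundedLT.induction generalizing σ with
    | _ a ih =>
      subst h
      by_cases hσ : RobinsonSchensted.shape σ ∈ Γ
      · exact Submodule.mem_sup_left (Submodule.subset_span ⟨σ, hσ, rfl⟩)
      · obtain ⟨f, hf, hmem⟩ := exists_carryingSum_mem_youngIdeal R hΓ hΔ hσ
        have hσf : σ ∈ carrying f (fun v => f (σ v)) := mem_carrying.2 fun _ => rfl
        have e := Finset.add_sum_erase _ (fun π => MonoidAlgebra.of R _ π) hσf
        rw [← eq_sub_iff_add_eq] at e
        rw [e]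
        refine Submodule.sub_mem _ (Submodule.mem_sup_right hmem)
          (Submodule.sum_mem _ fun π hπ => ?_)
        rw [Finset.mem_erase] at hπ
        exact ih _ (toLex_lt_of_mem_carrying hf hπ.2 hπ.1) π rfl
  rw [eq_top_iff]
  intro x _
  induction x using MonoidAlgebra.induction_on with
  | of σ => exact key σ
  | add x y hx hy => exact Submodule.add_mem _ (hx trivial) (hy trivial)
  | smul r x hx => exact Submodule.smul_mem _ _ (hx trivial)

theorem isUpperSet_compl_image_conj (hΓ : IsUpperSet (Γ : Set n.Partition))
    (hΔ : Δ = Finset.univ \ Γ.image Nat.Partition.conj) : IsUpperSet (Δ : Set n.Partition) := by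
  intro l m hlm hl
  rw [hΔ] at hl ⊢
  simp only [Finset.coe_sdiff, Finset.coe_univ, Set.mem_sdiff, Set.mem_univ, true_and,
    Finset.mem_coe, Finset.mem_image, not_exists, not_and] at hl ⊢
  rintro k hk rfl
  refine hl l.conj (hΓ (a := k) ?_ hk) l.conj_conj
  rw [← k.conj_conj]
  exact Nat.Partition.conj_antitone hlm

theorem card_shape_mem (Γ : Finset n.Partition) :
    Fintype.card {σ : Equiv.Perm (Fin n) // RobinsonSchensted.shape σ ∈ Γ}
      = ∑ l ∈ Γ, l.numStandard ^ 2 := by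
  rw [Fintype.card_subtype, Finset.card_eq_sum_card_fiberwise (f := RobinsonSchensted.shape)
    (t := Γ) (fun p hp => by simpa using hp)]
  refine Finset.sum_congr rfl fun l hl => ?_
  rw [Finset.filter_filter, ← card_shape_eq, Nat.card_eq_fintype_card, Fintype.card_subtype]
  congr 1
  ext σ
  simp only [Finset.mem_filter, Finset.mem_univ, true_and]
  exact ⟨fun h => h.2, fun h => ⟨h ▸ hl, h⟩⟩

theorem card_tableauPair_notMem (hΔ : Δ = Finset.univ \ Γ.image Nat.Partition.conj) :
    Fintype.card {p : TableauPair n // p.1 ∉ Δ} = ∑ l ∈ Γ, l.numStandard ^ 2 := by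
  have h := card_tableauPair_mem (Γ.image Nat.Partition.conj)
  rw [Finset.sum_image (Nat.Partition.conj_injective.injOn)] at h
  simp only [Nat.Partition.numStandard_conj] at h
  rw [← h]
  refine Fintype.card_congr (Equiv.subtypeEquivRight fun p => ?_)
  rw [hΔ]
  simp

/-- The coordinates outside `Δ` kill the ideal, so the permutations with shapes in `Γ` already map
onto them. Both free modules have rank ∑ f_l² over `Γ`, as transposition preserves f_l; hence this
surjection is injective, while it vanishes on the intersection. -/
theorem disjoint_spanG_youngIdeal (hΓ' : ∀ l, l ∈ Γ ↔ ν ≤ l)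
    (hΓ : IsUpperSet (Γ : Set n.Partition))
    (hΔ : Δ = Finset.univ \ Γ.image Nat.Partition.conj) :
    Disjoint (spanG R Γ) (youngIdeal R Δ) := by
  have hup := isUpperSet_compl_image_conj hΓ hΔ
  let G := {σ : Equiv.Perm (Fin n) // RobinsonSchensted.shape σ ∈ Γ}
  let S := {p : TableauPair n // p.1 ∉ Δ}
  let φ : (G → R) →ₗ[R] MonoidAlgebra R (Equiv.Perm (Fin n)) :=
    Fintype.linearCombination R fun σ : G => MonoidAlgebra.of R _ σ.1
  have hφ : LinearMap.range φ = spanG R Γ := by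
    rw [Fintype.range_linearCombination, spanG]
    congr 1
    ext x
    simp [G]
  let ψ : MonoidAlgebra R (Equiv.Perm (Fin n)) →ₗ[R] (S → R) :=
    LinearMap.pi fun p => (rowBasis R).coord p.1
  have hψ : ∀ x ∈ youngIdeal R Δ, ψ x = 0 := fun x hx => funext fun p =>
    repr_eq_zero_of_mem_youngIdeal R hup hx p.2
  have hsurj : Function.Surjective (ψ ∘ₗ φ) := by
    intro d
    have hx : ∑ p : S, d p • rowBasis R p.1 ∈ spanG R Γ ⊔ youngIdeal R Δ := by
      rw [codisjoint_spanG_youngIdeal R hΓ' hΔ]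
      trivial
    obtain ⟨g, hg, y, hy, hgy⟩ := Submodule.mem_sup.1 hx
    rw [← hφ] at hg
    obtain ⟨c, rfl⟩ := hg
    refine ⟨c, ?_⟩
    have h1 := congrArg ψ hgy
    rw [map_add, hψ y hy, add_zero] at h1
    rw [LinearMap.comp_apply, h1]
    funext q
    classical
    simp only [ψ, map_sum, map_smul, LinearMap.pi_apply, Module.Basis.coord_apply,
      Module.Basis.repr_self, Finsupp.single_apply,
      Subtype.val_inj, smul_eq_mul, mul_ite, mul_one, mul_zero]
    rw [Finset.sum_ite_eq' Finset.univ q d, if_pos (Finset.mem_univ q)]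
  have hcard : Fintype.card G = Fintype.card S :=
    (card_shape_mem Γ).trans (card_tableauPair_notMem hΔ).symm
  have hinj : Function.Injective (ψ ∘ₗ φ) :=
    OrzechProperty.injective_of_surjective_of_injective
      (LinearEquiv.funCongrLeft R R (Fintype.equivOfCardEq hcard).symm).toLinearMap _
      (LinearEquiv.injective _) hsurj
  rw [Submodule.disjoint_def]
  intro x hx hx'
  rw [← hφ] at hx
  obtain ⟨c, rfl⟩ := hx
  rw [hinj (a₁ := c) (a₂ := 0) (by rw [map_zero]; exact hψ _ hx'), map_zero]

end

/-! ## Change of coefficients and signs -/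

theorem fromInt_of (σ : Equiv.Perm (Fin n)) :
    fromInt R (MonoidAlgebra.of ℤ _ σ) = MonoidAlgebra.of R _ σ := by
  simp [fromInt]

theorem fromInt_rowSum (p : TableauPair n) : fromInt R (rowSum ℤ p) = rowSum R p := by
  rw [rowSum, rowSum, carryingSum, carryingSum, map_sum]
  exact Finset.sum_congr rfl fun σ _ => fromInt_of R σ

theorem dagger_of (σ : Equiv.Perm (Fin n)) :
    dagger R (MonoidAlgebra.of R _ σ)
      = ((Equiv.Perm.sign σ : ℤ) : R) • MonoidAlgebra.of R _ σ := by
  change daggerHom R (MonoidAlgebra.single σ 1) = _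
  rw [daggerHom_single]
  simp

theorem fromInt_dagger_carryingSum (f g : Fin n → ℕ) :
    fromInt R (dagger ℤ (carryingSum ℤ f g)) = dagger R (carryingSum R f g) := by
  rw [carryingSum, carryingSum, map_sum, map_sum, map_sum]
  refine Finset.sum_congr rfl fun σ _ => ?_
  rw [dagger_of, dagger_of]
  rcases Int.units_eq_one_or (Equiv.Perm.sign σ) with h | h <;>
    simp [h, -MonoidAlgebra.of_apply, fromInt_of]

theorem map_dagger_spanG (Γ : Finset n.Partition) :
    (spanG R Γ).map (dagger R).toLinearMap = spanG R Γ := by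
  have h : (spanG R Γ).map (dagger R).toLinearMap ≤ spanG R Γ := by
    rw [Submodule.map_le_iff_le_comap, spanG, Submodule.span_le]
    rintro _ ⟨σ, hσ, rfl⟩
    change dagger R (MonoidAlgebra.of R _ σ) ∈ spanG R Γ
    rw [dagger_of]
    exact Submodule.smul_mem _ _ (Submodule.subset_span ⟨σ, hσ, rfl⟩)
  refine le_antisymm h fun x hx => ⟨dagger R x, h ⟨x, hx, rfl⟩, ?_⟩
  exact DFunLike.congr_fun (daggerHom_comp R) x

/-- The comparison map for submodules with bases that correspond to each other. -/
theorem exists_baseChange_equiv {ι : Type*}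
    {N : Submodule ℤ (MonoidAlgebra ℤ (Equiv.Perm (Fin n)))}
    {N' : Submodule R (MonoidAlgebra R (Equiv.Perm (Fin n)))}
    (b : Module.Basis ι ℤ N) (b' : Module.Basis ι R N')
    (h : ∀ i, fromInt R (b i).1 = (b' i).1) :
    ∃ e : R ⊗[ℤ] N ≃ₗ[R] N', ∀ (r : R) (x : N),
      (e (r ⊗ₜ[ℤ] x) : MonoidAlgebra R (Equiv.Perm (Fin n))) = r • fromInt R x.1 := by
  let e := (b.baseChange R).equiv b' (Equiv.refl ι)
  -- It is enough to treat `r = 1`, where both maps are ℤ-linear in `x` and are compared on the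
  -- basis.
  have key : (N'.subtype.restrictScalars ℤ ∘ₗ e.toLinearMap.restrictScalars ℤ ∘ₗ
      TensorProduct.mk ℤ R N 1) = (fromInt R).toAddMonoidHom.toIntLinearMap ∘ₗ N.subtype := by
    refine b.ext fun i => ?_
    have h1 : e (1 ⊗ₜ[ℤ] b i) = b' i := by
      rw [← Module.Basis.baseChange_apply, Module.Basis.equiv_apply, Equiv.refl_apply]
    change (e (1 ⊗ₜ[ℤ] b i)).1 = fromInt R (b i).1
    rw [h1, h]
  refine ⟨e, fun r x => ?_⟩
  have h1 : r ⊗ₜ[ℤ] x = r • ((1 : R) ⊗ₜ[ℤ] x) := by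
    rw [TensorProduct.smul_tmul', smul_eq_mul, mul_one]
  rw [h1, map_smul, Submodule.coe_smul]
  exact congrArg (r • ·) (LinearMap.congr_fun key x)

/-- The signed row sums of the shapes in `Δ` form a basis of the image of the ideal under `†`. -/
noncomputable def youngIdealDaggerBasis {Δ : Finset n.Partition}
    (hΔ : IsUpperSet (Δ : Set n.Partition)) :
    Module.Basis {p : TableauPair n // p.1 ∈ Δ} R (youngIdealDagger R Δ) :=
  (youngIdealBasis R hΔ).map ((dagger R).toLinearEquiv.submoduleMap (youngIdeal R Δ))

theorem youngIdealDaggerBasis_apply {Δ : Finset n.Partition}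
    (hΔ : IsUpperSet (Δ : Set n.Partition)) (p : {p : TableauPair n // p.1 ∈ Δ}) :
    (youngIdealDaggerBasis R hΔ p : MonoidAlgebra R (Equiv.Perm (Fin n)))
      = dagger R (rowSum R p.1) := by
  rw [← youngIdealBasis_apply R hΔ]
  rfl

end SymGroupAlgebra

theorem proposition2p8 (n : ℕ) (hn : 0 < n) (R : Type*) [CommRing R]
    (Γ : Finset n.Partition) (hΓ : IsUpperSet (Γ : Set n.Partition))
    (hmin : ∃! μ : n.Partition, Minimal (· ∈ Γ) μ)
    (Δ : Finset n.Partition) (hΔ : Δ = Finset.univ \ Γ.image Nat.Partition.conj) :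
    (IsCompl (SymGroupAlgebra.spanG R Γ) (SymGroupAlgebra.youngIdeal R Δ) ∧
      IsCompl (SymGroupAlgebra.spanG R Γ) (SymGroupAlgebra.youngIdealDagger R Δ)) ∧
    (Nonempty (Module.Basis (Fin (∑ l ∈ Δ, l.numStandard ^ 2)) R
        (SymGroupAlgebra.youngIdeal R Δ)) ∧
      ∃ e : R ⊗[ℤ] SymGroupAlgebra.youngIdeal ℤ Δ ≃ₗ[R] SymGroupAlgebra.youngIdeal R Δ,
        ∀ (r : R) (x : SymGroupAlgebra.youngIdeal ℤ Δ),
          (e (r ⊗ₜ[ℤ] x) : MonoidAlgebra R (Equiv.Perm (Fin n)))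
            = r • SymGroupAlgebra.fromInt R x.1) ∧
    (Nonempty (Module.Basis (Fin (∑ l ∈ Δ, l.numStandard ^ 2)) R
        (SymGroupAlgebra.youngIdealDagger R Δ)) ∧
      ∃ e : R ⊗[ℤ] SymGroupAlgebra.youngIdealDagger ℤ Δ ≃ₗ[R]
          SymGroupAlgebra.youngIdealDagger R Δ,
        ∀ (r : R) (x : SymGroupAlgebra.youngIdealDagger ℤ Δ),
          (e (r ⊗ₜ[ℤ] x) : MonoidAlgebra R (Equiv.Perm (Fin n)))
            = r • SymGroupAlgebra.fromInt R x.1) := by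
  obtain ⟨ν, hν, huniq⟩ := hmin
  -- In a finite set every element lies above a minimal one, so the unique minimal element is the
  -- least.
  have hΓ' : ∀ l, l ∈ Γ ↔ ν ≤ l := fun l => by
    refine ⟨fun hl => ?_, fun hl => hΓ hl hν.prop⟩
    obtain ⟨m, hml, hm⟩ := Γ.exists_le_minimal hl
    exact huniq m hm ▸ hml
  have hup := SymGroupAlgebra.isUpperSet_compl_image_conj hΓ hΔ
  have hcompl : IsCompl (SymGroupAlgebra.spanG R Γ) (SymGroupAlgebra.youngIdeal R Δ) :=
    ⟨SymGroupAlgebra.disjoint_spanG_youngIdeal R hΓ' hΓ hΔ,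
      codisjoint_iff.2 (SymGroupAlgebra.codisjoint_spanG_youngIdeal R hΓ' hΔ)⟩
  let ε := Fintype.equivFinOfCardEq (SymGroupAlgebra.card_tableauPair_mem Δ)
  refine ⟨⟨hcompl, ?_⟩, ⟨⟨(SymGroupAlgebra.youngIdealBasis R hup).reindex ε⟩, ?_⟩,
    ⟨(SymGroupAlgebra.youngIdealDaggerBasis R hup).reindex ε⟩, ?_⟩
  -- The automorphism † maps the span of the permutations with shapes in `Γ` onto itself, so it
  -- carries one decomposition to the other.
  · have := hcompl.map (Submodule.orderIsoMapComap (SymGroupAlgebra.dagger R).toLinearEquiv)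
    rw [← SymGroupAlgebra.map_dagger_spanG]
    exact this
  · refine SymGroupAlgebra.exists_baseChange_equiv R (SymGroupAlgebra.youngIdealBasis ℤ hup)
      (SymGroupAlgebra.youngIdealBasis R hup) fun p => ?_
    rw [SymGroupAlgebra.youngIdealBasis_apply, SymGroupAlgebra.youngIdealBasis_apply,
      SymGroupAlgebra.fromInt_rowSum]
  · refine SymGroupAlgebra.exists_baseChange_equiv R (SymGroupAlgebra.youngIdealDaggerBasis ℤ hup)
      (SymGroupAlgebra.youngIdealDaggerBasis R hup) fun p => ?_
    rw [SymGroupAlgebra.youngIdealDaggerBasis_apply, SymGroupAlgebra.youngIdealDaggerBasis_apply]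
    exact SymGroupAlgebra.fromInt_dagger_carryingSum R _ _
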